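/- We work in many-sorted first-order logic with equality. Every sort of a structure has a non-empty domain. A $\Sigma$-theory is a set of first-order $\Sigma$-sentences, and it is consistent if it has a model. Let $\varphi(\underline{x},\underline{p})$ be a quantifier-free formula over the symbols of $\Sigma$, with a finite tuple $\underline{x}$ of variables whose sorts lie in $\Sigma$, and a finite tuple $\underline{p}$ of fresh predicate symbols (not in $\Sigma$) with arguments of sorts of $\Sigma$. It is $T$-satisfiable if there are a model $\mathcal{M}$ of $T$, a valuation $v$ of $\underline{x}$ in $\mathcal{M}$ and an interpretation $b$ of $\underline{p}$ by relations on $\mathcal{M}$ with $\mathcal{M},v,b\models\varphi(\underline{x},\underline{p})$. For a $\Sigma$-theory $T$, the $T$-satisfiability problem is decidable if the set of all $T$-satisfiable quantifier-free formulas $\varphi(\underline{x},\underline{p})$ of this kind, written as strings over a countable alphabet in which symbols are given by natural-number names together with their ranks, is recursive. For a sort $S$ and a finite set $C=\{c_1,\dots,c_n\}$, $n\ge 1$, of constants of sort $S$, the enumerated data-type theory $\mathit{EDT}(C,S)$ is the theory, in the signature that consists of the sort $S$ and the constants $c_1,\dots,c_n$, with the axioms $$\bigwedge_{i\neq j} c_i\neq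 c_j\qquad\text{and}\qquad \forall x{:}S.\ \bigvee_{i=1}^n x=c_i .$$ **Lemma.** Let $T_{\mathit{sub}}$ be an enumerated data-type theory with signature $\Sigma_{\mathit{sub}}$. Let $T_{\mathit{WF}}\supseteq T_{\mathit{sub}}$ be a $\Sigma_{\mathit{WF}}$-theory and $T_{\mathit{PM}}\supseteq T_{\mathit{sub}}$ a $\Sigma_{\mathit{PM}}$-theory, where $\Sigma_{\mathit{WF}}\cap\Sigma_{\mathit{PM}}=\Sigma_{\mathit{sub}}$. Suppose that both theories are consistent and that the $T_{\mathit{WF}}$-satisfiability problem and the $T_{\mathit{PM}}$-satisfiability problem are decidable. Then, for the theory $T_{\mathit{SOA}}=T_{\mathit{WF}}\cup T_{\mathit{PM}}$ in the signature $\Sigma_{\mathit{WF}}\cup\Sigma_{\mathit{PM}}$, the $T_{\mathit{SOA}}$-satisfiability problem is decidable. -/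

import Mathlib

/-! Many-sorted first-order logic with equality, satisfiability of quantifier-free formulae modulo
a theory, and enumerated data-type theories.

Sort symbols, variables and the names of function and predicate symbols are natural numbers.
A function or predicate symbol carries its rank, so a signature is just a set of sorts, function
symbols and predicate symbols, and signatures and theories can be intersected and united
literally. -/

namespace ManySorted

/-- A function symbol `name : dom₁ × ⋯ × domₖ → cod`; a constant has `dom = []`. -/
structure FunSym where
  name : ℕ
  dom : List ℕ
  cod : ℕ

/-- A predicate symbol `name : dom₁ × ⋯ × domₖ`. -/
structure PredSym where
  name : ℕ
  dom : List ℕ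

/-- A many-sorted signature: the sorts in the ranks of its symbols belong to it. -/
@[ext]
structure Signature where
  sorts : Set ℕ
  funs : Set FunSym
  preds : Set PredSym
  dom_mem : ∀ f ∈ funs, ∀ s ∈ f.dom, s ∈ sorts
  cod_mem : ∀ f ∈ funs, f.cod ∈ sorts
  pdom_mem : ∀ P ∈ preds, ∀ s ∈ P.dom, s ∈ sorts

instance : Union Signature where
  union L L' :=
    { sorts := L.sorts ∪ L'.sorts
      funs := L.funs ∪ L'.funs
      preds := L.preds ∪ L'.preds
      dom_mem := fun f hf s hs =>
        hf.imp (fun h => L.dom_mem f h s hs) (fun h => L'.dom_mem f h s hs)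
      cod_mem := fun f hf => hf.imp (L.cod_mem f) (L'.cod_mem f)
      pdom_mem := fun P hP s hs =>
        hP.imp (fun h => L.pdom_mem P h s hs) (fun h => L'.pdom_mem P h s hs) }

instance : Inter Signature where
  inter L L' :=
    { sorts := L.sorts ∩ L'.sorts
      funs := L.funs ∩ L'.funs
      preds := L.preds ∩ L'.preds
      dom_mem := fun f hf s hs => ⟨L.dom_mem f hf.1 s hs, L'.dom_mem f hf.2 s hs⟩
      cod_mem := fun f hf => ⟨L.cod_mem f hf.1, L'.cod_mem f hf.2⟩
      pdom_mem := fun P hP s hs => ⟨L.pdom_mem P hP.1 s hs, L'.pdom_mem P hP.2 s hs⟩ }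

/-! ### Syntax -/

/-- Terms, indexed by their sort. `var s n` is the `n`-th variable of sort `s`. -/
inductive Term : ℕ → Type
  | var (s n : ℕ) : Term s
  | app (f : FunSym) (args : ∀ i : Fin f.dom.length, Term (f.dom.get i)) : Term f.cod

/-- Formulae. `rel` applies a predicate symbol (of a signature), `pvar` applies a predicate
variable, i.e. a fresh predicate symbol that belongs to no signature. -/
inductive Formula : Type
  | falsum : Formula
  | eq {s : ℕ} (t u : Term s) : Formula
  | rel (P : PredSym) (args : ∀ i : Fin P.dom.length, Term (P.dom.get i)) : Formula
  | pvar (P : PredSym) (args : ∀ i : Fin P.dom.length, Term (P.dom.get i)) : Formula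
  | imp (φ ψ : Formula) : Formula
  | all (s n : ℕ) (φ : Formula) : Formula

namespace Term

/-- The term uses only sorts and function symbols of `L`. -/
def Over (L : Signature) : {s : ℕ} → Term s → Prop
  | _, var s _ => s ∈ L.sorts
  | _, app f args => f ∈ L.funs ∧ ∀ i, (args i).Over L

/-- The variables (sort and index) that occur in a term. -/
def vars : {s : ℕ} → Term s → Set (ℕ × ℕ)
  | _, var s n => {(s, n)}
  | _, app _ args => ⋃ i, (args i).vars

/-- The constant with name `c` and sort `S`, as a term. -/
def const (S c : ℕ) : Term S := app ⟨c, [], S⟩ (fun i => i.elim0)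

end Term

namespace Formula

def neg (φ : Formula) : Formula := imp φ falsum
def verum : Formula := neg falsum
def and (φ ψ : Formula) : Formula := neg (imp φ (neg ψ))
def or (φ ψ : Formula) : Formula := imp (neg φ) ψ

/-- Finite conjunction. -/
def conj (l : List Formula) : Formula := l.foldr and verum

/-- Finite disjunction. -/
def disj (l : List Formula) : Formula := l.foldr or falsum

/-- The formula uses only sorts, function symbols and predicate symbols of `L`; predicate variables
whose rank consists of sorts of `L` are allowed. -/
def Over (L : Signature) : Formula → Prop
  | falsum => True
  | eq t u => t.Over L ∧ u.Over L
  | rel P args => P ∈ L.preds ∧ ∀ i, (args i).Over L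
  | pvar P args => (∀ s ∈ P.dom, s ∈ L.sorts) ∧ ∀ i, (args i).Over L
  | imp φ ψ => φ.Over L ∧ ψ.Over L
  | all s _ φ => s ∈ L.sorts ∧ φ.Over L

def freeVars : Formula → Set (ℕ × ℕ)
  | falsum => ∅
  | eq t u => t.vars ∪ u.vars
  | rel _ args => ⋃ i, (args i).vars
  | pvar _ args => ⋃ i, (args i).vars
  | imp φ ψ => φ.freeVars ∪ ψ.freeVars
  | all s n φ => φ.freeVars \ {(s, n)}

/-- No predicate variable occurs in the formula. -/
def NoPredVar : Formula → Prop
  | falsum => True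
  | eq _ _ => True
  | rel _ _ => True
  | pvar _ _ => False
  | imp φ ψ => φ.NoPredVar ∧ ψ.NoPredVar
  | all _ _ φ => φ.NoPredVar

def QuantifierFree : Formula → Prop
  | falsum => True
  | eq _ _ => True
  | rel _ _ => True
  | pvar _ _ => True
  | imp φ ψ => φ.QuantifierFree ∧ ψ.QuantifierFree
  | all _ _ _ => False

/-- `φ` is a sentence of signature `L`: no free variables and no predicate variables. -/
def IsSentence (L : Signature) (φ : Formula) : Prop :=
  φ.Over L ∧ φ.freeVars = ∅ ∧ φ.NoPredVar

end Formula

/-! ### Semantics -/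

/-- A structure, with a non-empty domain for every sort. For convenience it interprets all symbols;
the truth of a formula of signature `L` depends only on the sorts and symbols of `L`, and every
structure that interprets `L` alone extends to one that interprets everything. -/
structure Structure where
  carrier : ℕ → Type
  nonempty : ∀ s, Nonempty (carrier s)
  funMap : ∀ f : FunSym, (∀ i : Fin f.dom.length, carrier (f.dom.get i)) → carrier f.cod
  relMap : ∀ P : PredSym, (∀ i : Fin P.dom.length, carrier (P.dom.get i)) → Prop

namespace Structure

/-- Assignments of domain elements to the first-order variables. -/
abbrev Valuation (M : Structure) : Type := ∀ s : ℕ, ℕ → M.carrier s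

/-- Assignments of relations to the predicate variables. -/
abbrev RelValuation (M : Structure) : Type :=
  ∀ P : PredSym, (∀ i : Fin P.dom.length, M.carrier (P.dom.get i)) → Prop

end Structure

def Term.eval (M : Structure) (v : M.Valuation) : {s : ℕ} → Term s → M.carrier s
  | _, .var s n => v s n
  | _, .app f args => M.funMap f (fun i => (args i).eval M v)

/-- `M, v, b ⊨ φ`. -/
def Formula.Realize (M : Structure) (b : M.RelValuation) : M.Valuation → Formula → Prop
  | _, .falsum => False
  | v, .eq t u => t.eval M v = u.eval M v
  | v, .rel P args => M.relMap P (fun i => (args i).eval M v)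
  | v, .pvar P args => b P (fun i => (args i).eval M v)
  | v, .imp φ ψ => φ.Realize M b v → ψ.Realize M b v
  | v, .all s n φ =>
      ∀ a : M.carrier s, φ.Realize M b (Function.update v s (Function.update (v s) n a))

/-- `T` is an `L`-theory: a set of sentences of signature `L`. -/
def IsTheory (L : Signature) (T : Set Formula) : Prop :=
  ∀ φ ∈ T, φ.IsSentence L

/-- `M` is a model of the set of sentences `T`. -/
def Structure.Models (M : Structure) (T : Set Formula) : Prop :=
  ∀ φ ∈ T, ∀ (b : M.RelValuation) (v : M.Valuation), φ.Realize M b v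

/-- `T` has a model. -/
def Consistent (T : Set Formula) : Prop :=
  ∃ M : Structure, M.Models T

/-- `φ` is `T`-satisfiable: `M, v, b ⊨ φ` for some model `M` of `T`, some valuation `v` of the
variables and some valuation `b` of the predicate variables. -/
def Satisfiable (T : Set Formula) (φ : Formula) : Prop :=
  ∃ M : Structure, M.Models T ∧ ∃ (b : M.RelValuation) (v : M.Valuation), φ.Realize M b v

/-! ### Formulae as strings, and decidability -/

/-- The alphabet in which formulae are written. -/
inductive Token : Type
  | var (s n : ℕ) : Token
  | fn (f : FunSym) : Token
  | rel (P : PredSym) : Token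
  | pvar (P : PredSym) : Token
  | falsum : Token
  | eq : Token
  | imp : Token
  | all (s n : ℕ) : Token

/-- Terms in Polish notation. -/
def Term.encode : {s : ℕ} → Term s → List Token
  | _, .var s n => [.var s n]
  | _, .app f args => .fn f :: (List.ofFn fun i => (args i).encode).flatten

/-- Formulae in Polish notation. -/
def Formula.encode : Formula → List Token
  | .falsum => [.falsum]
  | .eq t u => .eq :: (t.encode ++ u.encode)
  | .rel P args => .rel P :: (List.ofFn fun i => (args i).encode).flatten
  | .pvar P args => .pvar P :: (List.ofFn fun i => (args i).encode).flatten
  | .imp φ ψ => .imp :: (φ.encode ++ ψ.encode)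
  | .all s n φ => .all s n :: φ.encode

def FunSym.equiv : FunSym ≃ ℕ × List ℕ × ℕ where
  toFun f := (f.name, f.dom, f.cod)
  invFun p := ⟨p.1, p.2.1, p.2.2⟩

def PredSym.equiv : PredSym ≃ ℕ × List ℕ where
  toFun P := (P.name, P.dom)
  invFun p := ⟨p.1, p.2⟩

instance : Primcodable FunSym := Primcodable.ofEquiv _ FunSym.equiv

instance : Primcodable PredSym := Primcodable.ofEquiv _ PredSym.equiv

def Token.equiv :
    Token ≃ ((ℕ × ℕ) ⊕ FunSym) ⊕ (PredSym ⊕ PredSym) ⊕ (ℕ × ℕ) ⊕ Fin 3 where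
  toFun
    | .var s n => .inl (.inl (s, n))
    | .fn f => .inl (.inr f)
    | .rel P => .inr (.inl (.inl P))
    | .pvar P => .inr (.inl (.inr P))
    | .all s n => .inr (.inr (.inl (s, n)))
    | .falsum => .inr (.inr (.inr 0))
    | .eq => .inr (.inr (.inr 1))
    | .imp => .inr (.inr (.inr 2))
  invFun
    | .inl (.inl p) => .var p.1 p.2
    | .inl (.inr f) => .fn f
    | .inr (.inl (.inl P)) => .rel P
    | .inr (.inl (.inr P)) => .pvar P
    | .inr (.inr (.inl p)) => .all p.1 p.2
    | .inr (.inr (.inr 0)) => .falsum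
    | .inr (.inr (.inr 1)) => .eq
    | .inr (.inr (.inr 2)) => .imp
  left_inv x := by cases x <;> rfl
  right_inv x := by
    rcases x with (_ | _) | (_ | _) | _ | i
    · rfl
    · rfl
    · rfl
    · rfl
    · rfl
    · fin_cases i <;> rfl

instance : Primcodable Token := Primcodable.ofEquiv _ Token.equiv

/-- The `T`-satisfiability problem for quantifier-free formulae of signature `L`: the set of strings
that represent a `T`-satisfiable quantifier-free formula built from the symbols of `L`,
variables and predicate variables. -/
def SatProblem (L : Signature) (T : Set Formula) (w : List Token) : Prop :=
  ∃ φ : Formula, φ.encode = w ∧ φ.Over L ∧ φ.QuantifierFree ∧ Satisfiable T φ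

/-- The satisfiability problem is (Turing) decidable. -/
def DecidableSat (L : Signature) (T : Set Formula) : Prop :=
  ComputablePred (SatProblem L T)

/-! ### Enumerated data types -/

/-- The signature with the sort `S` and the constants of `C`, all of sort `S`. -/
def edtSignature (S : ℕ) (C : List ℕ) : Signature where
  sorts := {S}
  funs := {f | ∃ c ∈ C, f = ⟨c, [], S⟩}
  preds := ∅
  dom_mem := by
    rintro _ ⟨c, _, rfl⟩ s hs
    simp at hs
  cod_mem := by
    rintro _ ⟨c, _, rfl⟩
    rfl
  pdom_mem := by
    intro P hP
    simp at hP

/-- `⋀ c ≠ c'` over all distinct `c, c' ∈ C`. -/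
def edtDistinct (S : ℕ) (C : List ℕ) : Formula :=
  .conj (((C ×ˢ C).filter fun p => p.1 ≠ p.2).map fun p =>
    .neg (.eq (Term.const S p.1) (Term.const S p.2)))

/-- `∀ x : S, ⋁ x = c` over all `c ∈ C`. -/
def edtExhaustive (S : ℕ) (C : List ℕ) : Formula :=
  .all S 0 (.disj (C.map fun c => .eq (.var S 0) (Term.const S c)))

/-- `T` is the enumerated data-type theory of a non-empty finite set of constants of one sort,
and `L` is its signature. -/
def IsEnumeratedDataType (L : Signature) (T : Set Formula) : Prop :=
  ∃ (S : ℕ) (C : List ℕ), C ≠ [] ∧ C.Nodup ∧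
    L = edtSignature S C ∧ T = {edtDistinct S C, edtExhaustive S C}

end ManySorted

namespace ManySorted

/-! ### Annotated formulae

A formula in Polish notation is annotated with a number at every position: the truth value of the
subformula that starts there, or the name of the element denoted by the subterm that starts there.
-/

/-! Satisfiability modulo the union is decided by guessing a finite description of the relevant part
of a model and asking each theory about its own half. Given `M, v, b ⊨ φ`, label every subformula
with its truth value and every subterm with a name of its value: a constant in the enumerated sort,
a small number in the other sorts. What `φ` sees of `M` is then a finite list of facts `f(a₁,…,aₖ) =
a` and `P(a₁,…,aₖ)` or its negation. The facts about the symbols of one signature, together with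
disequalities between different names, form a pure conjunction of literals: the query to that
theory. The length of `φ` and the constants bound the names, so finitely many labellings suffice.

Conversely, let a labelling be locally correct and let both queries have models `M₁` and `M₂`. The
shared signature consists of one sort and its constants, and in both models these constants
enumerate that sort without repetition. Matching equal constants is therefore an isomorphism of the
shared reducts, and it respects names because the queries mention shared elements only through
constants. Every other sort belongs to at most one signature, so the two models glue
(`exists_glued_structure`), and sentences transfer along the isomorphisms of reducts
(`ReductIso.models`). Predicate variables, whose arguments may mix sorts of both signatures, enter
no query: different names denote different elements, so any functional list of facts about them is
realised by a relation (`exists_interprets`).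

Two points make this effective. A stack machine checks the syntax of the string while it collects
the facts (`Interprets.parse`). Membership in the signatures, which are not assumed recursive, is
read off from the given decision procedures by means of valid formulas, which every consistent
theory satisfies (`DecidableSat.computable_sorts` and its analogues). The resulting equivalence is
`satProblem_union_iff`. -/

instance : DecidableEq FunSym := FunSym.equiv.decidableEq

instance : DecidableEq PredSym := PredSym.equiv.decidableEq

instance : DecidableEq Token := Token.equiv.decidableEq

/-- Case distinction on tokens. -/
def Token.elim {σ : Type*} (gv : ℕ × ℕ → σ) (gf : FunSym → σ) (gr gp : PredSym → σ) (g₀ ge gi : σ)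
    (ga : ℕ × ℕ → σ) : Token → σ
  | .var s n => gv (s, n)
  | .fn f => gf f
  | .rel P => gr P
  | .pvar P => gp P
  | .falsum => g₀
  | .eq => ge
  | .imp => gi
  | .all s n => ga (s, n)

/-- The number of arguments of a token. -/
def Token.arity : Token → ℕ :=
  Token.elim (fun _ => 0) (fun f => f.dom.length) (fun P => P.dom.length) (fun P => P.dom.length)
    0 2 2 (fun _ => 1)

/-- The kind of the expressions that start with a token: `s + 1` for terms of sort `s`, and `0` for
formulae. -/
def Token.kind : Token → ℕ :=
  Token.elim (fun p => p.1 + 1) (fun f => f.cod + 1) (fun _ => 0) (fun _ => 0) 0 0 0 (fun _ => 0)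

/-- A symbol, the kinds and values of its arguments, and the value of its application. -/
abbrev Fact : Type := Token × List (ℕ × ℕ) × ℕ

/-- The kind and value of the result recorded in a fact. -/
def Fact.out (x : Fact) : ℕ × ℕ := (x.1.kind, x.2.2)

/-- The first component is the stack of expressions read so far, the leftmost on top; the second is
the log of facts. If the stack is too short, the recorded argument list is too short as well, and
`Fact.check` rejects it. -/
def runStep (p : Token × ℕ) (σ : List (ℕ × ℕ) × List Fact) : List (ℕ × ℕ) × List Fact :=
  ((p.1.kind, p.2) :: σ.1.drop p.1.arity, (p.1, σ.1.take p.1.arity, p.2) :: σ.2)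

/-- The stack machine that reads an annotated string from right to left. -/
def run (A : List (Token × ℕ)) : List (ℕ × ℕ) × List Fact :=
  A.foldr runStep ([], [])

/-- The annotations of a string by numbers below `B`. -/
def annotations (B : ℕ) (w : List Token) : List (List (Token × ℕ)) :=
  w.foldr (fun t l => l.flatMap fun A => (List.range B).map fun k => (t, k) :: A) [[]]

theorem mem_annotations {B : ℕ} {w : List Token} {A : List (Token × ℕ)} :
    A ∈ annotations B w ↔ A.map Prod.fst = w ∧ ∀ p ∈ A, p.2 < B := by
  induction w generalizing A with
  | nil =>
    simp only [annotations, List.foldr_nil, List.mem_singleton, List.map_eq_nil_iff]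
    constructor
    · rintro rfl
      simp
    · exact fun h => h.1
  | cons t w ih =>
    have hstep : annotations B (t :: w) = (annotations B w).flatMap
      fun A => (List.range B).map fun k => (t, k) :: A := rfl
    simp only [hstep, List.mem_flatMap, List.mem_map, List.mem_range, ih]
    constructor
    · rintro ⟨A', ⟨h₁, h₂⟩, k, hk, rfl⟩
      simpa [h₁, hk] using h₂
    · rintro ⟨h₁, h₂⟩
      cases A with
      | nil => simp at h₁
      | cons p A =>
        simp only [List.map_cons, List.cons.injEq] at h₁
        refine ⟨A, ⟨h₁.2, fun q hq => h₂ q (by simp [hq])⟩, p.2, h₂ p (by simp), ?_⟩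
        rw [← h₁.1]

/-- The value of the `i`-th argument. -/
def argVal (args : List (ℕ × ℕ)) (i : ℕ) : ℕ := (args.getD i (0, 0)).2

/-- The elements of the enumerated sort are named by its constants. -/
def nameOK (S : ℕ) (C : List ℕ) (k a : ℕ) : Bool := !decide (k = S + 1) || decide (a ∈ C)

/-- A fact is well-sorted, uses only known symbols, and evaluates the logical symbols correctly. -/
def Fact.check (S : ℕ) (C : List ℕ) (mS : ℕ → Bool) (mF : FunSym → Bool) (mP : PredSym → Bool)
    (x : Fact) : Bool :=
  ((x.2.1.all fun p => nameOK S C p.1 p.2) && nameOK S C x.1.kind x.2.2) &&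
  Token.elim (fun p => mS p.1)
    (fun f => mF f && decide (x.2.1.map Prod.fst = f.dom.map Nat.succ))
    (fun P => mP P && decide (x.2.1.map Prod.fst = P.dom.map Nat.succ))
    (fun P => decide (x.2.1.map Prod.fst = P.dom.map Nat.succ))
    (!decide (x.2.2 = 1))
    -- The list of kinds must have length two, so the default of `getD` never lets a short list
    -- pass. Kind `0` is excluded because equality relates terms, not formulas.
    (decide (x.2.1.map Prod.fst = [(x.2.1.getD 0 (0, 0)).1, (x.2.1.getD 0 (0, 0)).1]) &&
      (!decide ((x.2.1.getD 0 (0, 0)).1 = 0) &&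
        (decide (x.2.2 = 1) == decide (argVal x.2.1 0 = argVal x.2.1 1))))
    (decide (x.2.1.map Prod.fst = [0, 0]) &&
      (decide (x.2.2 = 1) == (!decide (argVal x.2.1 0 = 1) || decide (argVal x.2.1 1 = 1))))
    -- Quantifiers are rejected.
    (fun _ => false) x.1

/-- Two facts do not contradict the functionality of their symbol. -/
def Fact.compat (x y : Fact) : Bool :=
  !(decide (x.1 = y.1) && decide (x.2.1 = y.2.1)) || decide (x.2.2 = y.2.2)

def goodFacts (S : ℕ) (C : List ℕ) (mS : ℕ → Bool) (mF : FunSym → Bool) (mP : PredSym → Bool)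
    (F : List Fact) : Bool :=
  F.all (Fact.check S C mS mF mP) && F.all fun x => F.all fun y => x.compat y

/-! ### The queries -/

/-- The token for the element of kind `p.1` with name `p.2`. -/
def nameToken (S : ℕ) (p : ℕ × ℕ) : Token :=
  bif decide (p.1 = S + 1) then .fn ⟨p.2, [], S⟩ else .var (p.1 - 1) p.2

/-- The literal that states a fact, preceded by an implication sign. -/
def Fact.literal (S : ℕ) (mF : FunSym → Bool) (mP : PredSym → Bool) (x : Fact) : List Token :=
  Token.elim (fun _ => [])
    (fun f => bif mF f then
      .imp :: .eq :: .fn f :: (x.2.1.map (nameToken S) ++ [nameToken S (f.cod + 1, x.2.2)])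
      else [])
    (fun P => bif mP P then
      (bif decide (x.2.2 = 1) then .imp :: .rel P :: x.2.1.map (nameToken S)
        else .imp :: .imp :: .rel P :: (x.2.1.map (nameToken S) ++ [.falsum]))
      else [])
    -- The logical symbols and the variables are settled by `Fact.check` and `Fact.compat`; so are
    -- predicate variables, whose ranks may mix sorts of both signatures.
    (fun _ => []) [] [] [] (fun _ => []) x.1

/-- The literal that states that two elements are different, preceded by an implication sign. -/
def Fact.separation (S : ℕ) (mS : ℕ → Bool) (x y : Fact) : List Token :=
  -- No literal is needed in the enumerated sort, whose constants are already distinct in every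
  -- model of the theory.
  bif decide (x.out.1 = y.out.1) && (!decide (x.out.1 = 0) && (!decide (x.out.1 = S + 1) &&
      (mS (x.out.1 - 1) && !decide (x.out.2 = y.out.2)))) then
    [.imp, .imp, .eq, nameToken S x.out, nameToken S y.out, .falsum]
  else []

/-- The conjunction of the literals over one signature that follow from the given facts. -/
def query (S : ℕ) (mS : ℕ → Bool) (mF : FunSym → Bool) (mP : PredSym → Bool) (F : List Fact) :
    List Token :=
  -- The string denotes `(φ₁ → (φ₂ → ⋯ → ⊥)) → ⊥`, a conjunction. In Polish notation it arises by
  -- mere concatenation, the two final tokens being the end of the chain and the conclusion of the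
  -- outer implication.
  .imp :: (((F.flatMap fun x => x.literal S mF mP) ++
    (F.flatMap fun x => F.flatMap fun y => x.separation S mS y)) ++ [.falsum, .falsum])

end ManySorted

/-! ### Computability of list operations -/

namespace Computable

variable {α β σ : Type*} [Primcodable α] [Primcodable β] [Primcodable σ]

/-- A fold is a recursion on the number of entries consumed, the next entry being fetched by its
index. Computability in place of primitive recursiveness matters, since the tests for membership in
the signatures are merely computable. -/
theorem list_foldl {f : α → List β} {g : α → σ} {h : α → σ × β → σ} (hf : Computable f)
    (hg : Computable g) (hh : Computable₂ h) :
    Computable fun a => (f a).foldl (fun s b => h a (s, b)) (g a) := by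
  have key : Computable fun a => Nat.rec (motive := fun _ => σ) (g a)
      (fun n s => (Option.casesOn ((f a)[n]?) s fun b => h a (s, b) : σ)) (f a).length := by
    refine nat_rec (h := fun a p => (Option.casesOn ((f a)[p.1]?) p.2 fun b => h a (p.2, b) : σ))
      (list_length.comp hf) hg ?_
    refine option_casesOn
      (list_getElem?.comp (hf.comp fst) (fst.comp snd)) (snd.comp snd) ?_
    exact hh.comp (fst.comp fst) (pair (snd.comp (snd.comp fst)) snd)
  refine key.of_eq fun a => ?_
  generalize g a = s₀
  -- After `n` rounds the recursion has folded the first `n` entries.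
  have aux : ∀ n ≤ (f a).length, Nat.rec (motive := fun _ => σ) s₀
      (fun n s => (Option.casesOn ((f a)[n]?) s fun b => h a (s, b) : σ)) n =
      ((f a).take n).foldl (fun s b => h a (s, b)) s₀ := by
    intro n
    induction n with
    | zero => simp
    | succ n ih =>
      intro hn
      have hlt : n < (f a).length := hn
      simp only [ih hlt.le, List.getElem?_eq_getElem hlt]
      rw [← List.take_concat_get' _ _ hlt, List.foldl_append]
      rfl
  simpa using aux _ le_rfl

theorem list_foldr {f : α → List β} {g : α → σ} {h : α → β × σ → σ} (hf : Computable f)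
    (hg : Computable g) (hh : Computable₂ h) :
    Computable fun a => (f a).foldr (fun b s => h a (b, s)) (g a) :=
  (list_foldl (h := fun a p => h a (p.2, p.1)) (list_reverse.comp hf) hg
    (hh.comp fst (pair (snd.comp snd) (fst.comp snd)))).of_eq fun a => by simp

theorem list_flatMap {f : α → List β} {g : α → β → List σ} (hf : Computable f)
    (hg : Computable₂ g) : Computable fun a => (f a).flatMap (g a) :=
  (list_foldr (h := fun a p => g a p.1 ++ p.2) hf (const [])
    (list_append.comp (hg.comp fst (fst.comp snd)) (snd.comp snd))).of_eq fun a => by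
      induction f a with
      | nil => rfl
      | cons b l ih => simp [ih]

theorem list_map {f : α → List β} {g : α → β → σ} (hf : Computable f) (hg : Computable₂ g) :
    Computable fun a => (f a).map (g a) :=
  (list_flatMap (g := fun a b => [g a b]) hf (list_cons.comp hg (const []))).of_eq fun a => by
    rw [List.map_eq_flatMap]

theorem and {f g : α → Bool} (hf : Computable f) (hg : Computable g) :
    Computable fun a => f a && g a :=
  (Primrec.and.to_comp).comp hf hg

theorem or {f g : α → Bool} (hf : Computable f) (hg : Computable g) :
    Computable fun a => f a || g a :=
  (Primrec.or.to_comp).comp hf hg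

theorem not {f : α → Bool} (hf : Computable f) : Computable fun a => !f a :=
  (Primrec.not.to_comp).comp hf

theorem beq [DecidableEq β] {f g : α → β} (hf : Computable f) (hg : Computable g) :
    Computable fun a => decide (f a = g a) :=
  (Primrec.eq.decide.to_comp).comp hf hg

theorem list_all {f : α → List β} {g : α → β → Bool} (hf : Computable f) (hg : Computable₂ g) :
    Computable fun a => (f a).all (g a) :=
  (list_foldr (h := fun a p => g a p.1 && p.2) hf (const true)
    (and (hg.comp fst (fst.comp snd)) (snd.comp snd))).of_eq fun a => by
      induction f a with
      | nil => rfl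
      | cons b l ih => simp [ih]

theorem list_any {f : α → List β} {g : α → β → Bool} (hf : Computable f) (hg : Computable₂ g) :
    Computable fun a => (f a).any (g a) :=
  (list_foldr (h := fun a p => g a p.1 || p.2) hf (const false)
    (or (hg.comp fst (fst.comp snd)) (snd.comp snd))).of_eq fun a => by
      induction f a with
      | nil => rfl
      | cons b l ih => simp [ih]

end Computable

namespace ManySorted

open Computable

/-! ### Computability of the stack machine, the local tests and the queries -/

section Computability

variable {α σ : Type*} [Primcodable α] [Primcodable σ]

theorem computable_tokenEquiv : Computable Token.equiv := (Primrec.of_equiv (e := Token.equiv)).to_comp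

theorem computable_tokenEquiv_symm : Computable Token.equiv.symm :=
  (Primrec.of_equiv_symm (e := Token.equiv)).to_comp

theorem computable_fn : Computable Token.fn :=
  computable_tokenEquiv_symm.comp (sumInl.comp sumInr)

theorem computable_rel : Computable Token.rel :=
  computable_tokenEquiv_symm.comp (sumInr.comp (sumInl.comp sumInl))

theorem computable_var : Computable fun p : ℕ × ℕ => Token.var p.1 p.2 :=
  computable_tokenEquiv_symm.comp (sumInl.comp sumInl)

theorem computable_funSym : Computable fun p : ℕ × List ℕ × ℕ => FunSym.mk p.1 p.2.1 p.2.2 :=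
  (Primrec.of_equiv_symm (e := FunSym.equiv)).to_comp

theorem computable_funSym_dom : Computable FunSym.dom :=
  (fst.comp snd).comp (Primrec.of_equiv (e := FunSym.equiv)).to_comp

theorem computable_funSym_cod : Computable FunSym.cod :=
  (snd.comp snd).comp (Primrec.of_equiv (e := FunSym.equiv)).to_comp

theorem computable_predSym_dom : Computable PredSym.dom :=
  snd.comp (Primrec.of_equiv (e := PredSym.equiv)).to_comp

theorem computable_tokenElim {t : α → Token} {gv ga : α → ℕ × ℕ → σ} {gf : α → FunSym → σ}
    {gr gp : α → PredSym → σ} {g₀ ge gi : α → σ} (ht : Computable t) (hv : Computable₂ gv)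
    (hf : Computable₂ gf) (hr : Computable₂ gr) (hp : Computable₂ gp) (h₀ : Computable g₀)
    (he : Computable ge) (hi : Computable gi) (ha : Computable₂ ga) :
    Computable fun a =>
      Token.elim (gv a) (gf a) (gr a) (gp a) (g₀ a) (ge a) (gi a) (ga a) (t a) := by
  have hfin : Computable₂ fun (a : α) (i : Fin 3) =>
      (bif decide (i = 0) then g₀ a else bif decide (i = 1) then ge a else gi a : σ) :=
    cond (beq snd (const 0)) (h₀.comp fst) (cond (beq snd (const 1)) (he.comp fst) (hi.comp fst))
  have hleft : Computable₂ fun (a : α) (q : (ℕ × ℕ) ⊕ FunSym) =>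
      (Sum.casesOn q (gv a) (gf a) : σ) :=
    sumCasesOn (f := Prod.snd) (g := fun (p : α × ((ℕ × ℕ) ⊕ FunSym)) q => gv p.1 q)
      (h := fun p q => gf p.1 q) snd (hv.comp (fst.comp fst) snd) (hf.comp (fst.comp fst) snd)
  have hpred : Computable₂ fun (a : α) (q : PredSym ⊕ PredSym) =>
      (Sum.casesOn q (gr a) (gp a) : σ) :=
    sumCasesOn (f := Prod.snd) (g := fun (p : α × (PredSym ⊕ PredSym)) q => gr p.1 q)
      (h := fun p q => gp p.1 q) snd (hr.comp (fst.comp fst) snd) (hp.comp (fst.comp fst) snd)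
  have hlast : Computable₂ fun (a : α) (q : (ℕ × ℕ) ⊕ Fin 3) =>
      (Sum.casesOn q (ga a) fun i =>
        bif decide (i = 0) then g₀ a else bif decide (i = 1) then ge a else gi a : σ) :=
    sumCasesOn (f := Prod.snd) (g := fun (p : α × ((ℕ × ℕ) ⊕ Fin 3)) q => ga p.1 q)
      (h := fun p i => (bif decide (i = 0) then g₀ p.1 else
        bif decide (i = 1) then ge p.1 else gi p.1 : σ)) snd
      (ha.comp (fst.comp fst) snd) (hfin.comp (fst.comp fst) snd)
  have hright : Computable₂ fun (a : α) (q : (PredSym ⊕ PredSym) ⊕ (ℕ × ℕ) ⊕ Fin 3) =>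
      (Sum.casesOn q (fun r => Sum.casesOn r (gr a) (gp a)) (fun r => Sum.casesOn r (ga a) fun i =>
        bif decide (i = 0) then g₀ a else bif decide (i = 1) then ge a else gi a) : σ) := by
    have h₁ : Computable₂ fun (p : α × ((PredSym ⊕ PredSym) ⊕ (ℕ × ℕ) ⊕ Fin 3))
        (r : PredSym ⊕ PredSym) => (Sum.casesOn r (gr p.1) (gp p.1) : σ) :=
      hpred.comp (fst.comp fst) snd
    have h₂ : Computable₂ fun (p : α × ((PredSym ⊕ PredSym) ⊕ (ℕ × ℕ) ⊕ Fin 3))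
        (r : (ℕ × ℕ) ⊕ Fin 3) => (Sum.casesOn r (ga p.1) fun i =>
          bif decide (i = 0) then g₀ p.1 else bif decide (i = 1) then ge p.1 else gi p.1 : σ) :=
      hlast.comp (fst.comp fst) snd
    exact sumCasesOn (f := Prod.snd) snd h₁ h₂
  refine (sumCasesOn (computable_tokenEquiv.comp ht) hleft hright).of_eq fun a => ?_
  generalize t a = u
  cases u <;> simp [Token.elim, Token.equiv]

theorem computable_arity : Computable Token.arity :=
  computable_tokenElim (t := id) (gv := fun _ _ => 0) (gf := fun _ f => f.dom.length)
    (gr := fun _ P => P.dom.length) (gp := fun _ P => P.dom.length) (g₀ := fun _ => 0)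
    (ge := fun _ => 2) (gi := fun _ => 2) (ga := fun _ _ => 1) Computable.id (const 0)
    (list_length.comp (computable_funSym_dom.comp snd))
    (list_length.comp (computable_predSym_dom.comp snd))
    (list_length.comp (computable_predSym_dom.comp snd)) (const 0) (const 2) (const 2) (const 1)

theorem computable_kind : Computable Token.kind :=
  computable_tokenElim (t := id) (gv := fun _ p => p.1 + 1) (gf := fun _ f => f.cod + 1)
    (gr := fun _ _ => 0) (gp := fun _ _ => 0) (g₀ := fun _ => 0)
    (ge := fun _ => 0) (gi := fun _ => 0) (ga := fun _ _ => 0) Computable.id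
    (succ.comp (fst.comp snd)) (succ.comp (computable_funSym_cod.comp snd))
    (const 0) (const 0) (const 0) (const 0) (const 0) (const 0)

theorem computable_run : Computable run := by
  refine list_foldr (h := fun _ p => runStep p.1 p.2) Computable.id (const ([], [])) ?_
  have htok : Computable fun q : List (Token × ℕ) × ((Token × ℕ) × List (ℕ × ℕ) × List Fact) =>
      q.2.1.1 := fst.comp (fst.comp snd)
  have hval : Computable fun q : List (Token × ℕ) × ((Token × ℕ) × List (ℕ × ℕ) × List Fact) =>
      q.2.1.2 := snd.comp (fst.comp snd)
  have hst : Computable fun q : List (Token × ℕ) × ((Token × ℕ) × List (ℕ × ℕ) × List Fact) =>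
      q.2.2.1 := fst.comp (snd.comp snd)
  have hfa : Computable fun q : List (Token × ℕ) × ((Token × ℕ) × List (ℕ × ℕ) × List Fact) =>
      q.2.2.2 := snd.comp (snd.comp snd)
  exact pair
    (list_cons.comp (pair (computable_kind.comp htok) hval)
      (Primrec.list_drop.to_comp.comp (computable_arity.comp htok) hst))
    (list_cons.comp
      (pair htok (pair (Primrec.list_take.to_comp.comp (computable_arity.comp htok) hst) hval)) hfa)

theorem computable_annotations : Computable₂ annotations := by
  refine list_foldr (f := fun p : ℕ × List Token => p.2)
    (h := fun p q => q.2.flatMap fun A => (List.range p.1).map fun k => (q.1, k) :: A)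
    snd (const [[]]) ?_
  refine list_flatMap (snd.comp snd) ?_
  refine list_map (Primrec.list_range.to_comp.comp (fst.comp (fst.comp fst))) ?_
  exact list_cons.comp (pair (fst.comp (snd.comp (fst.comp fst))) snd) (snd.comp fst)

theorem computable_argKey {i : ℕ} {f : α → Fact} (hf : Computable f) :
    Computable fun a => (f a).2.1.getD i (0, 0) :=
  (Primrec.list_getD (0, 0)).to_comp.comp (fst.comp (snd.comp hf)) (const i)

theorem computable_nameOK (S : ℕ) (C : List ℕ) : Computable₂ (nameOK S C) := by
  have hmem : Computable fun a : ℕ => decide (a ∈ C) :=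
    (list_any (g := fun a c => decide (c = a)) (const C) (beq snd fst)).of_eq fun a => by
      rw [Bool.eq_iff_iff]
      simp
  exact or (not (beq fst (const (S + 1)))) (hmem.comp snd)

variable {mS : ℕ → Bool} {mF : FunSym → Bool} {mP : PredSym → Bool}

theorem computable_check (S : ℕ) (C : List ℕ) (hS : Computable mS) (hF : Computable mF)
    (hP : Computable mP) : Computable (Fact.check S C mS mF mP) := by
  have hval : Computable fun x : Fact => x.2.2 := snd.comp snd
  have hkinds : Computable fun x : Fact => x.2.1.map Prod.fst :=
    list_map (fst.comp snd) (fst.comp snd)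
  have htrue : Computable fun x : Fact => decide (x.2.2 = 1) := beq hval (const 1)
  have hkey : Computable fun x : Fact => (x.2.1.getD 0 (0, 0)).1 :=
    fst.comp (computable_argKey Computable.id)
  have harg : ∀ i, Computable fun x : Fact => argVal x.2.1 i := fun i =>
    snd.comp (computable_argKey Computable.id)
  have hbeq : ∀ {f g : Fact → Bool}, Computable f → Computable g →
      Computable fun x => f x == g x := fun hf hg =>
    (beq hf hg).of_eq fun x => by
      rw [Bool.eq_iff_iff]
      simp
  have hdom : ∀ {γ : Type} [Primcodable γ] {d : γ → List ℕ}, Computable d →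
      Computable₂ fun (x : Fact) (f : γ) =>
        decide (x.2.1.map Prod.fst = (d f).map Nat.succ) := fun hd =>
    beq (hkinds.comp fst) (list_map (hd.comp snd) (succ.comp snd))
  have hnames : Computable fun x : Fact =>
      (x.2.1.all fun p => nameOK S C p.1 p.2) && nameOK S C x.1.kind x.2.2 :=
    and (list_all (g := fun (_ : Fact) (p : ℕ × ℕ) => nameOK S C p.1 p.2) (fst.comp snd)
      ((computable_nameOK S C).comp (fst.comp snd) (snd.comp snd)))
      ((computable_nameOK S C).comp (computable_kind.comp fst) hval)
  refine and hnames ?_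
  refine computable_tokenElim fst ?_ ?_ ?_ ?_ ?_ ?_ ?_ ?_
  · exact hS.comp (fst.comp snd)
  · exact and (hF.comp snd) (hdom computable_funSym_dom)
  · exact and (hP.comp snd) (hdom computable_predSym_dom)
  · exact hdom computable_predSym_dom
  · exact not htrue
  · exact and (beq hkinds (list_cons.comp hkey (list_cons.comp hkey (const []))))
      (and (not (beq hkey (const 0))) (hbeq htrue (beq (harg 0) (harg 1))))
  · exact and (beq hkinds (const [0, 0])) (hbeq htrue
      (or (not (beq (harg 0) (const 1))) (beq (harg 1) (const 1))))
  · exact const false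

theorem computable_compat : Computable₂ Fact.compat :=
  or (not (and (beq (fst.comp fst) (fst.comp snd))
    (beq (fst.comp (snd.comp fst)) (fst.comp (snd.comp snd)))))
    (beq (snd.comp (snd.comp fst)) (snd.comp (snd.comp snd)))

theorem computable_goodFacts (S : ℕ) (C : List ℕ) (hS : Computable mS) (hF : Computable mF)
    (hP : Computable mP) : Computable (goodFacts S C mS mF mP) := by
  refine and (list_all Computable.id ((computable_check S C hS hF hP).comp snd)) ?_
  refine list_all Computable.id (list_all fst ?_)
  exact computable_compat.comp (snd.comp fst) snd

theorem computable_nameToken (S : ℕ) : Computable (nameToken S) :=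
  cond (beq fst (const (S + 1)))
    (computable_fn.comp (computable_funSym.comp (pair snd (pair (const []) (const S)))))
    (computable_var.comp (pair (pred.comp fst) snd))

theorem computable_literal (S : ℕ) (hF : Computable mF) (hP : Computable mP) :
    Computable (Fact.literal S mF mP) := by
  have hval : Computable fun x : Fact => x.2.2 := snd.comp snd
  have hargs : Computable fun x : Fact => x.2.1.map (nameToken S) :=
    list_map (fst.comp snd) ((computable_nameToken S).comp snd)
  unfold Fact.literal
  refine computable_tokenElim fst (const []) ?_ ?_ (const []) (const []) (const []) (const [])
    (const [])
  · refine cond (hF.comp snd) ?_ (const [])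
    refine list_cons.comp (const _) (list_cons.comp (const _)
      (list_cons.comp (computable_fn.comp snd) (list_append.comp (hargs.comp fst) ?_)))
    exact list_cons.comp ((computable_nameToken S).comp
      (pair (succ.comp (computable_funSym_cod.comp snd)) (hval.comp fst))) (const [])
  · refine cond (hP.comp snd) (cond (beq (hval.comp fst) (const 1)) ?_ ?_) (const [])
    · exact list_cons.comp (const _) (list_cons.comp (computable_rel.comp snd) (hargs.comp fst))
    · exact list_cons.comp (const _) (list_cons.comp (const _)
        (list_cons.comp (computable_rel.comp snd) (list_append.comp (hargs.comp fst) (const _))))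

theorem computable_separation (S : ℕ) (hS : Computable mS) :
    Computable₂ (Fact.separation S mS) := by
  have hout : Computable Fact.out := pair (computable_kind.comp fst) (snd.comp snd)
  have h₁ : Computable fun p : Fact × Fact => p.1.out := hout.comp fst
  have h₂ : Computable fun p : Fact × Fact => p.2.out := hout.comp snd
  refine cond ?_ ?_ (const [])
  · exact and (beq (fst.comp h₁) (fst.comp h₂)) (and (not (beq (fst.comp h₁) (const 0)))
      (and (not (beq (fst.comp h₁) (const (S + 1)))) (and (hS.comp (pred.comp (fst.comp h₁)))
        (not (beq (snd.comp h₁) (snd.comp h₂))))))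
  · exact list_cons.comp (const _) (list_cons.comp (const _) (list_cons.comp (const _)
      (list_cons.comp ((computable_nameToken S).comp h₁)
        (list_cons.comp ((computable_nameToken S).comp h₂) (const _)))))

theorem computable_query (S : ℕ) (hS : Computable mS) (hF : Computable mF) (hP : Computable mP) :
    Computable (query S mS mF mP) := by
  refine list_cons.comp (const _) (list_append.comp (list_append.comp ?_ ?_) (const _))
  · exact list_flatMap Computable.id ((computable_literal S hF hP).comp snd)
  · refine list_flatMap Computable.id (list_flatMap fst ?_)
    exact (computable_separation S hS).comp (snd.comp fst) snd

end Computability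

/-! ### Unique readability -/

theorem flatten_ofFn_append_inj {n : ℕ} {a b : Fin n → List Token} {p : Fin n → Prop}
    (h : ∀ i r r', a i ++ r = b i ++ r' → p i ∧ r = r') (r r' : List Token)
    (hab : (List.ofFn a).flatten ++ r = (List.ofFn b).flatten ++ r') : (∀ i, p i) ∧ r = r' := by
  induction n with
  | zero => exact ⟨fun i => i.elim0, by simpa using hab⟩
  | succ n ih =>
    simp only [List.ofFn_succ, List.flatten_cons, List.append_assoc] at hab
    obtain ⟨h₀, hrest⟩ := h 0 _ _ hab
    obtain ⟨h₁, hr⟩ := ih (fun i => h i.succ) hrest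
    exact ⟨Fin.cases h₀ h₁, hr⟩

/-- The first token fixes the constructor and the sorts of the arguments. Arbitrary remainders are
allowed so that the induction can peel off one argument after another, and the sorts are not assumed
equal but recovered. -/
theorem Term.encode_append_inj {s : ℕ} (t : Term s) {s' : ℕ} (t' : Term s') (r r' : List Token)
    (h : t.encode ++ r = t'.encode ++ r') :
    (⟨s, t⟩ : Σ s, Term s) = ⟨s', t'⟩ ∧ r = r' := by
  induction t generalizing s' r r' with
  | var s n =>
    cases t' with
    | var s' n' =>
      simp only [Term.encode, List.cons_append, List.nil_append, List.cons.injEq,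
        Token.var.injEq] at h
      obtain ⟨⟨rfl, rfl⟩, rfl⟩ := h
      exact ⟨rfl, rfl⟩
    | app f args => simp [Term.encode] at h
  | app f args ih =>
    cases t' with
    | var s' n' => simp [Term.encode] at h
    | app f' args' =>
      simp only [Term.encode, List.cons_append, List.cons.injEq, Token.fn.injEq] at h
      obtain ⟨rfl, h⟩ := h
      obtain ⟨hargs, rfl⟩ := flatten_ofFn_append_inj
        (p := fun i => (⟨_, args i⟩ : Σ s, Term s) = ⟨_, args' i⟩)
        (fun i r r' hi => ih i (args' i) r r' hi) r r' h
      have : args = args' := funext fun i => eq_of_heq (Sigma.mk.inj (hargs i)).2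
      exact ⟨by rw [this], rfl⟩

theorem args_encode_append_inj {d : List ℕ} {args args' : ∀ i : Fin d.length, Term (d.get i)}
    {r r' : List Token} (h : (List.ofFn fun i => (args i).encode).flatten ++ r =
      (List.ofFn fun i => (args' i).encode).flatten ++ r') : args = args' ∧ r = r' := by
  obtain ⟨hargs, hr⟩ := flatten_ofFn_append_inj
    (p := fun i => (⟨_, args i⟩ : Σ s, Term s) = ⟨_, args' i⟩)
    (fun i r r' hi => (args i).encode_append_inj (args' i) r r' hi) r r' h
  exact ⟨funext fun i => eq_of_heq (Sigma.mk.inj (hargs i)).2, hr⟩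

theorem Formula.encode_append_inj (φ ψ : Formula) (r r' : List Token)
    (h : φ.encode ++ r = ψ.encode ++ r') : φ = ψ ∧ r = r' := by
  induction φ generalizing ψ r r' with
  | falsum => cases ψ <;> simp [Formula.encode] at h ⊢; exact h
  | eq t u =>
    cases ψ <;> simp only [Formula.encode, List.cons_append, List.append_assoc, List.cons.injEq,
      reduceCtorEq, false_and] at h
    obtain ⟨h₁, h⟩ := Term.encode_append_inj _ _ _ _ h.2
    obtain ⟨h₂, hr⟩ := Term.encode_append_inj _ _ _ _ h
    cases h₁
    cases h₂
    exact ⟨rfl, hr⟩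
  | rel P args =>
    cases ψ <;> simp only [Formula.encode, List.cons_append, List.cons.injEq, reduceCtorEq,
      false_and, Token.rel.injEq] at h
    obtain ⟨rfl, h⟩ := h
    obtain ⟨rfl, hr⟩ := args_encode_append_inj h
    exact ⟨rfl, hr⟩
  | pvar P args =>
    cases ψ <;> simp only [Formula.encode, List.cons_append, List.cons.injEq, reduceCtorEq,
      false_and, Token.pvar.injEq] at h
    obtain ⟨rfl, h⟩ := h
    obtain ⟨rfl, hr⟩ := args_encode_append_inj h
    exact ⟨rfl, hr⟩
  | imp φ₁ φ₂ ih₁ ih₂ =>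
    cases ψ <;> simp only [Formula.encode, List.cons_append, List.append_assoc, List.cons.injEq,
      reduceCtorEq, false_and] at h
    obtain ⟨rfl, h₁⟩ := ih₁ _ _ _ h.2
    obtain ⟨rfl, hr⟩ := ih₂ _ _ _ h₁
    exact ⟨rfl, hr⟩
  | all s n φ ih =>
    cases ψ <;> simp only [Formula.encode, List.cons_append, List.cons.injEq, reduceCtorEq,
      false_and, Token.all.injEq] at h
    obtain ⟨⟨rfl, rfl⟩, h⟩ := h
    obtain ⟨rfl, hr⟩ := ih _ _ _ h
    exact ⟨rfl, hr⟩

theorem Formula.encode_injective : Function.Injective Formula.encode := fun φ ψ h =>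
  (Formula.encode_append_inj φ ψ [] [] (by simpa using h)).1

theorem satProblem_encode {L : Signature} {T : Set Formula} {φ : Formula} :
    SatProblem L T φ.encode ↔ φ.Over L ∧ φ.QuantifierFree ∧ Satisfiable T φ := by
  constructor
  · rintro ⟨ψ, hψ, h⟩
    rwa [← Formula.encode_injective hψ]
  · exact fun h => ⟨φ, rfl, h⟩

/-! ### The meaning of the queries -/

/-- The term for the element of sort `s` with name `a`: a constant for the enumerated sort, and a
variable for the other sorts. -/
def nameTerm (S s a : ℕ) : Term s :=
  if h : S = s then cast (congrArg Term h) (Term.const S a) else .var s a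

theorem nameTerm_self (S a : ℕ) : nameTerm S S a = Term.const S a := by simp [nameTerm]

theorem nameTerm_of_ne {S s : ℕ} (h : s ≠ S) (a : ℕ) : nameTerm S s a = .var s a := by
  simp [nameTerm, h.symm]

theorem nameTerm_encode (S s a : ℕ) : (nameTerm S s a).encode = [nameToken S (s + 1, a)] := by
  rcases eq_or_ne s S with rfl | h
  · simp [nameTerm_self, Term.const, Term.encode, nameToken]
  · simp [nameTerm_of_ne h, Term.encode, nameToken, h]

theorem nameTerm_over {L : Signature} {S s a : ℕ} (hs : s ∈ L.sorts)
    (ha : s = S → (⟨a, [], S⟩ : FunSym) ∈ L.funs) : (nameTerm S s a).Over L := by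
  rcases eq_or_ne s S with rfl | h
  · rw [nameTerm_self]
    exact ⟨ha rfl, fun i => i.elim0⟩
  · rw [nameTerm_of_ne h]
    exact hs

/-- The element of sort `s` with name `a`. -/
def denot (M : Structure) (u : M.Valuation) (S s a : ℕ) : M.carrier s := (nameTerm S s a).eval M u

/-- The fact holds in the structure, if its symbol belongs to `L`. -/
def Fact.Holds (L : Signature) (S : ℕ) (x : Fact) (M : Structure) (u : M.Valuation) : Prop :=
  (∀ f, x.1 = .fn f → f ∈ L.funs →
    M.funMap f (fun i => denot M u S (f.dom.get i) (argVal x.2.1 i)) = denot M u S f.cod x.2.2) ∧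
  (∀ P, x.1 = .rel P → P ∈ L.preds →
    (M.relMap P (fun i => denot M u S (P.dom.get i) (argVal x.2.1 i)) ↔ x.2.2 = 1))

/-- Different names of elements of the same sort of `L` denote different elements. -/
def Fact.Separates (L : Signature) (S : ℕ) (x y : Fact) (M : Structure) (u : M.Valuation) : Prop :=
  ∀ s, x.out.1 = s + 1 → y.out.1 = s + 1 → s ≠ S → s ∈ L.sorts → x.out.2 ≠ y.out.2 →
    denot M u S s x.out.2 ≠ denot M u S s y.out.2

/-- The string is a sequence of quantifier-free formulae over `L`, each preceded by an implication
sign, whose conjunction expresses `R`. -/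
def Encodes (L : Signature) (w : List Token) (R : ∀ M : Structure, M.Valuation → Prop) : Prop :=
  ∃ l : List Formula, w = l.flatMap (fun φ => .imp :: φ.encode) ∧
    (∀ φ ∈ l, φ.Over L ∧ φ.QuantifierFree) ∧
    ∀ (M : Structure) (b : M.RelValuation) (u : M.Valuation),
      (∀ φ ∈ l, φ.Realize M b u) ↔ R M u

namespace Encodes

variable {L : Signature}

theorem nil {R : ∀ M : Structure, M.Valuation → Prop} (hR : ∀ M u, R M u) : Encodes L [] R :=
  ⟨[], by simp, by simp, by simp [hR]⟩

theorem single {w : List Token} {R : ∀ M : Structure, M.Valuation → Prop} (φ : Formula)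
    (hw : w = .imp :: φ.encode) (h₁ : φ.Over L) (h₂ : φ.QuantifierFree)
    (h : ∀ (M : Structure) (b : M.RelValuation) (u : M.Valuation), φ.Realize M b u ↔ R M u) :
    Encodes L w R :=
  ⟨[φ], by simp [hw], by simp [h₁, h₂], by simp [h]⟩

theorem append {w w' : List Token} {R R' : ∀ M : Structure, M.Valuation → Prop}
    (h : Encodes L w R) (h' : Encodes L w' R') :
    Encodes L (w ++ w') fun M u => R M u ∧ R' M u := by
  obtain ⟨l, rfl, hl, hR⟩ := h
  obtain ⟨l', rfl, hl', hR'⟩ := h'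
  refine ⟨l ++ l', by simp, ?_, fun M b u => ?_⟩
  · intro φ hφ
    exact (List.mem_append.1 hφ).elim (hl φ) (hl' φ)
  · refine Iff.trans ?_ (and_congr (hR M b u) (hR' M b u))
    simp only [List.mem_append, or_imp, forall_and]

theorem flatMap {ι : Type*} (F : List ι) {w : ι → List Token}
    {R : ι → ∀ M : Structure, M.Valuation → Prop} (h : ∀ x ∈ F, Encodes L (w x) (R x)) :
    Encodes L (F.flatMap w) fun M u => ∀ x ∈ F, R x M u := by
  induction F with
  | nil => exact nil (by simp)
  | cons x F ih =>
    simpa using (h x (by simp)).append (ih fun y hy => h y (by simp [hy]))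

/-- The chain of implications ending in `⊥` is the negation of the conjunction, and it is negated
once more. Since `R` ignores predicate variables, any interpretation of them will do. -/
theorem satProblem_iff {w : List Token} {R : ∀ M : Structure, M.Valuation → Prop}
    (h : Encodes L w R) (T : Set Formula) :
    SatProblem L T (.imp :: (w ++ [.falsum, .falsum])) ↔
      ∃ M : Structure, M.Models T ∧ ∃ u : M.Valuation, R M u := by
  obtain ⟨l, rfl, hl, hR⟩ := h
  have henc : Token.imp :: (l.flatMap (fun φ => .imp :: φ.encode) ++ [.falsum, .falsum]) =
      (Formula.neg (l.foldr Formula.imp Formula.falsum)).encode := by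
    have : ∀ l : List Formula, (l.foldr Formula.imp Formula.falsum).encode =
        l.flatMap (fun φ => .imp :: φ.encode) ++ [.falsum] := by
      intro l
      induction l with
      | nil => rfl
      | cons φ l ih => simp [Formula.encode, ih]
    simp [Formula.neg, Formula.encode, this]
  have hover : (Formula.neg (l.foldr Formula.imp Formula.falsum)).Over L ∧
      (Formula.neg (l.foldr Formula.imp Formula.falsum)).QuantifierFree := by
    have : (l.foldr Formula.imp Formula.falsum).Over L ∧ (l.foldr Formula.imp Formula.falsum).QuantifierFree := by
      clear hR henc
      induction l with
      | nil => exact ⟨trivial, trivial⟩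
      | cons φ l ih =>
        have := ih fun ψ hψ => hl ψ (by simp [hψ])
        have hφ := hl φ (by simp)
        exact ⟨⟨hφ.1, this.1⟩, hφ.2, this.2⟩
    exact ⟨⟨this.1, trivial⟩, this.2, trivial⟩
  have hreal : ∀ (M : Structure) (b : M.RelValuation) (u : M.Valuation),
      (Formula.neg (l.foldr Formula.imp Formula.falsum)).Realize M b u ↔ R M u := by
    intro M b u
    rw [← hR M b u]
    have : ∀ l : List Formula, (l.foldr Formula.imp Formula.falsum).Realize M b u ↔
        ¬ ∀ φ ∈ l, φ.Realize M b u := by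
      intro l
      induction l with
      | nil => simp [Formula.Realize]
      | cons φ l ih => simp [Formula.Realize, ih]
    simp [Formula.neg, Formula.Realize, this]
  rw [henc, satProblem_encode]
  constructor
  · rintro ⟨-, -, M, hM, b, u, h⟩
    exact ⟨M, hM, u, (hreal M b u).1 h⟩
  · rintro ⟨M, hM, u, h⟩
    exact ⟨hover.1, hover.2, M, hM, fun _ _ => True, u, (hreal M _ u).2 h⟩

end Encodes

/-- Agreement of the kinds with the rank forces the right number of arguments, so the default value
in `argVal` is not used. -/
theorem argVal_eq {args : List (ℕ × ℕ)} {d : List ℕ} (h : args.map Prod.fst = d.map Nat.succ)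
    (i : Fin d.length) : ∃ hi : i < args.length, args[i] = (d.get i + 1, argVal args i) := by
  have hlen : args.length = d.length := by simpa using congrArg List.length h
  have hi : (i : ℕ) < args.length := lt_of_lt_of_eq i.2 hlen.symm
  refine ⟨hi, ?_⟩
  have h₁ : (args.map Prod.fst)[(i : ℕ)]'(by simpa using hi) = d.get i + 1 := by
    simp [h]
  rw [List.getElem_map] at h₁
  refine Prod.ext h₁ ?_
  simp [argVal, List.getD_eq_getElem?_getD, List.getElem?_eq_getElem hi]

theorem flatten_ofFn_singleton {n : ℕ} (g : Fin n → Token) :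
    (List.ofFn fun i => [g i]).flatten = List.ofFn g := by
  induction n with
  | zero => simp
  | succ n ih => simp [List.ofFn_succ, ih]

theorem argNames_encode {args : List (ℕ × ℕ)} {d : List ℕ}
    (h : args.map Prod.fst = d.map Nat.succ) (S : ℕ) :
    (List.ofFn fun i : Fin d.length => (nameTerm S (d.get i) (argVal args i)).encode).flatten =
      args.map (nameToken S) := by
  have hlen : args.length = d.length := by simpa using congrArg List.length h
  simp only [nameTerm_encode, flatten_ofFn_singleton]
  refine List.ext_getElem (by simp [hlen]) fun i h₁ h₂ => ?_
  simp only [List.length_ofFn] at h₁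
  obtain ⟨hi, heq⟩ := argVal_eq h ⟨i, h₁⟩
  simp only [List.getElem_ofFn, List.getElem_map]
  exact congrArg _ heq.symm

section Queries

variable {L : Signature} {S : ℕ} {C : List ℕ} {mS mS' : ℕ → Bool} {mF mF' : FunSym → Bool}
  {mP mP' : PredSym → Bool} {x : Fact}

theorem Fact.check_names (h : x.check S C mS mF mP = true) :
    (∀ p ∈ x.2.1, p.1 = S + 1 → p.2 ∈ C) ∧ (x.1.kind = S + 1 → x.2.2 ∈ C) := by
  simp only [Fact.check, nameOK, Bool.and_eq_true, List.all_eq_true, Bool.or_eq_true,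
    Bool.not_eq_true', decide_eq_false_iff_not, decide_eq_true_eq] at h
  exact ⟨fun p hp h' => (h.1.1 p hp).resolve_left (not_not.2 h'),
    fun h' => h.1.2.resolve_left (not_not.2 h')⟩

theorem argNames_over {d : List ℕ} {args : List (ℕ × ℕ)} (hC : ∀ c ∈ C, ⟨c, [], S⟩ ∈ L.funs)
    (hargs : ∀ p ∈ args, p.1 = S + 1 → p.2 ∈ C) (h : args.map Prod.fst = d.map Nat.succ)
    (hd : ∀ s ∈ d, s ∈ L.sorts) (i : Fin d.length) :
    (nameTerm S (d.get i) (argVal args i)).Over L := by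
  obtain ⟨hi, heq⟩ := argVal_eq h i
  refine nameTerm_over (hd _ (List.get_mem _ _)) fun hS => hC _ ?_
  have := hargs _ (List.getElem_mem hi)
  have h₂ := congrArg Prod.snd heq
  have h₁ := congrArg Prod.fst heq
  exact (show args[(i : ℕ)].2 = argVal args i from h₂) ▸ this (h₁.trans (congrArg Nat.succ hS))

/-- Two families of tests occur: the primed one, later that of the union, only guarantees
well-sortedness, while the unprimed one selects the symbols of `L`. For a symbol outside `L` the
literal is absent and `Fact.Holds` is vacuous. -/
theorem Fact.literal_encodes (hF : ∀ f, mF f = true ↔ f ∈ L.funs)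
    (hP : ∀ P, mP P = true ↔ P ∈ L.preds) (hC : ∀ c ∈ C, ⟨c, [], S⟩ ∈ L.funs)
    (hx : x.check S C mS' mF' mP' = true) :
    Encodes L (x.literal S mF mP) (x.Holds L S) := by
  obtain ⟨hargs, hout⟩ := Fact.check_names hx
  obtain ⟨t, args, a⟩ := x
  cases t with
  | fn f =>
    have hk : args.map Prod.fst = f.dom.map Nat.succ := by
      simp only [Fact.check, Token.elim, Bool.and_eq_true, decide_eq_true_eq] at hx
      exact hx.2.2
    cases hm : mF f with
    | false =>
      simp only [Fact.literal, Token.elim, hm, cond_false]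
      refine Encodes.nil fun M u => ⟨?_, by simp⟩
      rintro _ ⟨⟩ h
      rw [← hF, hm] at h
      cases h
    | true =>
      have hf := (hF f).1 hm
      simp only [Fact.literal, Token.elim, hm, cond_true]
      refine Encodes.single (.eq (.app f fun i => nameTerm S (f.dom.get i) (argVal args i))
        (nameTerm S f.cod a)) ?_ ⟨⟨hf, ?_⟩, ?_⟩ trivial fun M b u => ?_
      · simp [Formula.encode, Term.encode, nameTerm_encode, ← argNames_encode hk]
      · exact argNames_over hC hargs hk (L.dom_mem f hf)
      · exact nameTerm_over (L.cod_mem f hf) fun h => hC _ (hout (by simp [Token.kind, Token.elim, h]))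
      · simp only [Formula.Realize, Term.eval]
        constructor
        · intro h
          refine ⟨?_, by simp⟩
          rintro _ ⟨⟩ -
          exact h
        · exact fun h => h.1 f rfl hf
  | rel P =>
    have hk : args.map Prod.fst = P.dom.map Nat.succ := by
      simp only [Fact.check, Token.elim, Bool.and_eq_true, decide_eq_true_eq] at hx
      exact hx.2.2
    cases hm : mP P with
    | false =>
      simp only [Fact.literal, Token.elim, hm, cond_false]
      refine Encodes.nil fun M u => ⟨by simp, ?_⟩
      rintro _ ⟨⟩ h
      rw [← hP, hm] at h
      cases h
    | true =>
      have hPL := (hP P).1 hm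
      have hiff : ∀ (M : Structure) (u : M.Valuation), Fact.Holds L S (.rel P, args, a) M u ↔
          (M.relMap P (fun i => denot M u S (P.dom.get i) (argVal args i)) ↔ a = 1) := by
        intro M u
        constructor
        · exact fun h => h.2 P rfl hPL
        · intro h
          refine ⟨by simp, ?_⟩
          rintro _ ⟨⟩ -
          exact h
      simp only [Fact.literal, Token.elim, hm, cond_true]
      by_cases ha : a = 1
      · simp only [ha, decide_true, cond_true]
        refine Encodes.single (.rel P fun i => nameTerm S (P.dom.get i) (argVal args i))
          ?_ ⟨hPL, argNames_over hC hargs hk (L.pdom_mem P hPL)⟩ trivial fun M b u => ?_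
        · simp [Formula.encode, ← argNames_encode hk]
        · rw [← ha, hiff]
          simp [Formula.Realize, ha, denot]
      · simp only [ha, decide_false, cond_false]
        refine Encodes.single (.imp (.rel P fun i => nameTerm S (P.dom.get i) (argVal args i))
          .falsum) ?_ ⟨⟨hPL, argNames_over hC hargs hk (L.pdom_mem P hPL)⟩, trivial⟩
          ⟨trivial, trivial⟩ fun M b u => ?_
        · simp [Formula.encode, ← argNames_encode hk]
        · rw [hiff]
          simp [Formula.Realize, ha, denot]
  | _ => exact Encodes.nil fun M u => ⟨by simp, by simp⟩

theorem Fact.separation_encodes {y : Fact} (hS : ∀ s, mS s = true ↔ s ∈ L.sorts) :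
    Encodes L (x.separation S mS y) (x.Separates L S y) := by
  by_cases h : x.out.1 = y.out.1 ∧ x.out.1 ≠ 0 ∧ x.out.1 ≠ S + 1 ∧ x.out.1 - 1 ∈ L.sorts ∧
      x.out.2 ≠ y.out.2
  · obtain ⟨h₁, h₂, h₃, h₄, h₅⟩ := h
    obtain ⟨s, hs⟩ := Nat.exists_eq_succ_of_ne_zero h₂
    have hy : y.out.1 = s + 1 := h₁.symm.trans hs
    have hsS : s ≠ S := by
      rintro rfl
      exact h₃ hs
    have hsL : s ∈ L.sorts := by simpa [hs] using h₄
    have hxo : x.out = (s + 1, x.out.2) := Prod.ext hs rfl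
    have hyo : y.out = (s + 1, y.out.2) := Prod.ext hy rfl
    refine Encodes.single (.imp (.eq (nameTerm S s x.out.2) (nameTerm S s y.out.2)) .falsum)
      ?_ ⟨⟨?_, ?_⟩, trivial⟩ ⟨trivial, trivial⟩ fun M b u => ?_
    · have hm := (hS s).2 hsL
      have hc : (decide (x.out.1 = y.out.1) && (!decide (x.out.1 = 0) &&
          (!decide (x.out.1 = S + 1) &&
          (mS (x.out.1 - 1) && !decide (x.out.2 = y.out.2))))) = true := by
        simp [hs, hy, hsS, hm, h₅]
      rw [Fact.separation, hc, cond_true]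
      simp only [Formula.encode, nameTerm_encode, ← hxo, ← hyo]
      rfl
    · exact nameTerm_over hsL fun h => absurd h hsS
    · exact nameTerm_over hsL fun h => absurd h hsS
    · constructor
      · rintro h s' hs' - - - -
        obtain rfl : s' = s := by
          have : s' + 1 = s + 1 := hs'.symm.trans hs
          omega
        exact h
      · exact fun h => h s hs hy hsS hsL h₅
  -- Here no literal is produced, and the premises of `Fact.Separates` cannot all be met.
  · have hc : (decide (x.out.1 = y.out.1) && (!decide (x.out.1 = 0) &&
        (!decide (x.out.1 = S + 1) &&
        (mS (x.out.1 - 1) && !decide (x.out.2 = y.out.2))))) = false := by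
      rw [Bool.eq_false_iff]
      simpa only [ne_eq, Bool.and_eq_true, decide_eq_true_eq, Bool.not_eq_true',
        decide_eq_false_iff_not, hS] using h
    rw [Fact.separation, hc, cond_false]
    refine Encodes.nil fun M u s h₁ h₂ h₃ h₄ h₅ => absurd ⟨h₁.trans h₂.symm, ?_, ?_, ?_, h₅⟩ h
    · simp [h₁]
    · simpa [h₁] using h₃
    · simpa [h₁] using h₄

theorem satProblem_query {T : Set Formula} {F : List Fact} (hS : ∀ s, mS s = true ↔ s ∈ L.sorts)
    (hF : ∀ f, mF f = true ↔ f ∈ L.funs) (hP : ∀ P, mP P = true ↔ P ∈ L.preds)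
    (hC : ∀ c ∈ C, ⟨c, [], S⟩ ∈ L.funs) (hgood : ∀ x ∈ F, x.check S C mS' mF' mP' = true) :
    SatProblem L T (query S mS mF mP F) ↔ ∃ M : Structure, M.Models T ∧ ∃ u : M.Valuation,
      (∀ x ∈ F, x.Holds L S M u) ∧ ∀ x ∈ F, ∀ y ∈ F, x.Separates L S y M u :=
  ((Encodes.flatMap F fun x hx => Fact.literal_encodes hF hP hC (hgood x hx)).append
    (Encodes.flatMap F fun _ _ => Encodes.flatMap F fun _ _ =>
      Fact.separation_encodes hS)).satProblem_iff T

end Queries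

/-! ### Membership in a signature -/

theorem Term.mem_of_encode {L : Signature} {s : ℕ} (t : Term s) (ht : t.Over L) :
    (∀ s n, Token.var s n ∈ t.encode → s ∈ L.sorts) ∧
      (∀ f, Token.fn f ∈ t.encode → f ∈ L.funs) ∧
      (∀ P, Token.rel P ∈ t.encode → P ∈ L.preds) := by
  induction t with
  | var s n =>
    refine ⟨?_, by simp [Term.encode], by simp [Term.encode]⟩
    simp only [Term.encode, List.mem_singleton, Token.var.injEq]
    rintro _ _ ⟨rfl, rfl⟩
    exact ht
  | app f args ih =>
    simp only [Term.encode, List.mem_cons, List.mem_flatten, List.mem_ofFn]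
    refine ⟨?_, ?_, ?_⟩
    · rintro s n (⟨⟨⟩⟩ | ⟨_, ⟨i, rfl⟩, hi⟩)
      exact (ih i (ht.2 i)).1 s n hi
    · rintro g (h | ⟨_, ⟨i, rfl⟩, hi⟩)
      · cases h
        exact ht.1
      · exact (ih i (ht.2 i)).2.1 g hi
    · rintro P (⟨⟨⟩⟩ | ⟨_, ⟨i, rfl⟩, hi⟩)
      exact (ih i (ht.2 i)).2.2 P hi

/-- This makes membership in the problem informative about the signature: a string of the problem
contains symbols of `L` only. -/
theorem Formula.mem_of_encode {L : Signature} (φ : Formula) (hφ : φ.Over L)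
    (hq : φ.QuantifierFree) :
    (∀ s n, Token.var s n ∈ φ.encode → s ∈ L.sorts) ∧
      (∀ f, Token.fn f ∈ φ.encode → f ∈ L.funs) ∧
      (∀ P, Token.rel P ∈ φ.encode → P ∈ L.preds) := by
  induction φ with
  | falsum => simp [Formula.encode]
  | eq t u =>
    have ht := t.mem_of_encode hφ.1
    have hu := u.mem_of_encode hφ.2
    simp only [Formula.encode, List.mem_cons, List.mem_append, reduceCtorEq, false_or]
    exact ⟨fun s n h => h.elim (ht.1 s n) (hu.1 s n), fun f h => h.elim (ht.2.1 f) (hu.2.1 f),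
      fun P h => h.elim (ht.2.2 P) (hu.2.2 P)⟩
  | rel P args =>
    simp only [Formula.encode, List.mem_cons, List.mem_flatten, List.mem_ofFn]
    refine ⟨?_, ?_, ?_⟩
    · rintro s n (⟨⟨⟩⟩ | ⟨_, ⟨i, rfl⟩, hi⟩)
      exact ((args i).mem_of_encode (hφ.2 i)).1 s n hi
    · rintro g (⟨⟨⟩⟩ | ⟨_, ⟨i, rfl⟩, hi⟩)
      exact ((args i).mem_of_encode (hφ.2 i)).2.1 g hi
    · rintro Q (h | ⟨_, ⟨i, rfl⟩, hi⟩)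
      · cases h
        exact hφ.1
      · exact ((args i).mem_of_encode (hφ.2 i)).2.2 Q hi
  | pvar P args =>
    simp only [Formula.encode, List.mem_cons, List.mem_flatten, List.mem_ofFn]
    refine ⟨?_, ?_, ?_⟩
    · rintro s n (⟨⟨⟩⟩ | ⟨_, ⟨i, rfl⟩, hi⟩)
      exact ((args i).mem_of_encode (hφ.2 i)).1 s n hi
    · rintro g (⟨⟨⟩⟩ | ⟨_, ⟨i, rfl⟩, hi⟩)
      exact ((args i).mem_of_encode (hφ.2 i)).2.1 g hi
    · rintro Q (⟨⟨⟩⟩ | ⟨_, ⟨i, rfl⟩, hi⟩)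
      exact ((args i).mem_of_encode (hφ.2 i)).2.2 Q hi
  | imp φ ψ ih₁ ih₂ =>
    have h₁ := ih₁ hφ.1 hq.1
    have h₂ := ih₂ hφ.2 hq.2
    simp only [Formula.encode, List.mem_cons, List.mem_append, reduceCtorEq, false_or]
    exact ⟨fun s n h => h.elim (h₁.1 s n) (h₂.1 s n), fun f h => h.elim (h₁.2.1 f) (h₂.2.1 f),
      fun P h => h.elim (h₁.2.2 P) (h₂.2.2 P)⟩
  | all s n φ => exact hq.elim

section Membership

variable {L : Signature} {T : Set Formula}

open Computable

theorem DecidableSat.computable_preimage {α : Type*} [Primcodable α] (h : DecidableSat L T)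
    {g : α → List Token} (hg : Computable g) {p : α → Prop}
    (hp : ∀ a, SatProblem L T (g a) ↔ p a) :
    ∃ m : α → Bool, Computable m ∧ ∀ a, m a = true ↔ p a := by
  obtain ⟨_, hd⟩ := h
  exact ⟨fun a => decide (SatProblem L T (g a)), hd.comp hg, fun a => by simp [hp]⟩

/-- Consistency provides the model in which a valid formula holds; this is how it enters the
decision of the signatures. -/
theorem satisfiable_of_forall (hT : Consistent T) {φ : Formula}
    (h : ∀ (M : Structure) (b : M.RelValuation) (v : M.Valuation), φ.Realize M b v) :
    Satisfiable T φ := by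
  obtain ⟨M, hM⟩ := hT
  exact ⟨M, hM, fun _ _ => True, fun s _ => (M.nonempty s).some, h M _ _⟩

theorem flatten_ofFn_var (d : List ℕ) :
    (List.ofFn fun i : Fin d.length => (Term.var (d.get i) 0).encode).flatten =
      d.map fun s => Token.var s 0 := by
  simp only [Term.encode, flatten_ofFn_singleton]
  exact List.ext_getElem (by simp) fun i h₁ h₂ => by simp

theorem computable_map_var : Computable fun d : List ℕ => d.map fun s => Token.var s 0 := by
  have hv : Computable fun s => Token.var s 0 := computable_var.comp (pair Computable.id (const 0))
  exact list_map Computable.id (hv.comp snd)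

/-- The formula `x = x` is valid, so its string belongs to the problem exactly when the sort of `x`
lies in `L`. For function symbols `f(x,…) = f(x,…)` plays this role, for predicate symbols `P(x,…) →
P(x,…)`. -/
theorem DecidableSat.computable_sorts (h : DecidableSat L T) (hT : Consistent T) :
    ∃ m : ℕ → Bool, Computable m ∧ ∀ s, m s = true ↔ s ∈ L.sorts := by
  refine h.computable_preimage (g := fun s => [.eq, .var s 0, .var s 0]) ?_ fun s => ?_
  · have hv : Computable fun s => Token.var s 0 := computable_var.comp (pair Computable.id (const 0))
    exact list_cons.comp (const _) (list_cons.comp hv (list_cons.comp hv (const _)))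
  · constructor
    · rintro ⟨φ, hφ, h₁, h₂, -⟩
      exact (φ.mem_of_encode h₁ h₂).1 s 0 (by simp [hφ])
    · exact fun hs => ⟨.eq (.var s 0) (.var s 0), rfl, ⟨hs, hs⟩, trivial,
        satisfiable_of_forall hT fun M b v => rfl⟩

theorem DecidableSat.computable_funs (h : DecidableSat L T) (hT : Consistent T) :
    ∃ m : FunSym → Bool, Computable m ∧ ∀ f, m f = true ↔ f ∈ L.funs := by
  refine h.computable_preimage (g := fun f => .eq ::
    ((.fn f :: f.dom.map fun s => Token.var s 0) ++ .fn f :: f.dom.map fun s => Token.var s 0))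
    ?_ fun f => ?_
  · have hd : Computable fun f : FunSym => f.dom.map fun s => Token.var s 0 :=
      computable_map_var.comp computable_funSym_dom
    have hv : Computable fun f : FunSym => Token.fn f :: f.dom.map fun s => Token.var s 0 :=
      list_cons.comp computable_fn hd
    have hvv := list_append.comp hv hv
    exact list_cons.comp (const _) hvv
  · constructor
    · rintro ⟨φ, hφ, h₁, h₂, -⟩
      exact (φ.mem_of_encode h₁ h₂).2.1 f (by simp [hφ])
    · intro hf
      have hover : (Term.app f fun i => .var (f.dom.get i) 0).Over L :=
        ⟨hf, fun i => L.dom_mem f hf _ (List.get_mem _ _)⟩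
      refine ⟨.eq (.app f fun i => .var _ 0) (.app f fun i => .var _ 0), ?_, ⟨hover, hover⟩,
        trivial, satisfiable_of_forall hT fun M b v => rfl⟩
      rw [← flatten_ofFn_var]
      rfl

theorem DecidableSat.computable_preds (h : DecidableSat L T) (hT : Consistent T) :
    ∃ m : PredSym → Bool, Computable m ∧ ∀ P, m P = true ↔ P ∈ L.preds := by
  refine h.computable_preimage (g := fun P => .imp ::
    ((.rel P :: P.dom.map fun s => Token.var s 0) ++ .rel P :: P.dom.map fun s => Token.var s 0))
    ?_ fun P => ?_
  · have hd : Computable fun P : PredSym => P.dom.map fun s => Token.var s 0 :=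
      computable_map_var.comp computable_predSym_dom
    have hv : Computable fun P : PredSym => Token.rel P :: P.dom.map fun s => Token.var s 0 :=
      list_cons.comp computable_rel hd
    have hvv := list_append.comp hv hv
    exact list_cons.comp (const _) hvv
  · constructor
    · rintro ⟨φ, hφ, h₁, h₂, -⟩
      exact (φ.mem_of_encode h₁ h₂).2.2 P (by simp [hφ])
    · intro hP
      have hover : (Formula.rel P fun i => .var (P.dom.get i) 0).Over L :=
        ⟨hP, fun i => L.pdom_mem P hP _ (List.get_mem _ _)⟩
      refine ⟨.imp (.rel P fun i => .var _ 0) (.rel P fun i => .var _ 0), ?_, ⟨hover, hover⟩,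
        ⟨trivial, trivial⟩, satisfiable_of_forall hT fun M b v => id⟩
      rw [← flatten_ofFn_var]
      rfl

end Membership

/-! ### Models of enumerated data-type theories -/

/-- The value of the constant with name `c`. -/
def constVal (M : Structure) (S c : ℕ) : M.carrier S := M.funMap ⟨c, [], S⟩ fun i => i.elim0

theorem funMap_const (M : Structure) (S c : ℕ)
    (args : ∀ i : Fin (FunSym.mk c [] S).dom.length, M.carrier ((FunSym.mk c [] S).dom.get i)) :
    M.funMap ⟨c, [], S⟩ args = constVal M S c :=
  congrArg _ (funext fun i => i.elim0)

theorem const_eval (M : Structure) (v : M.Valuation) (S c : ℕ) :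
    (Term.const S c).eval M v = constVal M S c :=
  funMap_const M S c _

theorem denot_self (M : Structure) (u : M.Valuation) (S a : ℕ) :
    denot M u S S a = constVal M S a := by
  rw [denot, nameTerm_self, const_eval]

theorem denot_of_ne (M : Structure) (u : M.Valuation) {S s : ℕ} (h : s ≠ S) (a : ℕ) :
    denot M u S s a = u s a := by
  rw [denot, nameTerm_of_ne h, Term.eval]

theorem Formula.realize_conj {M : Structure} {b : M.RelValuation} {v : M.Valuation}
    (l : List Formula) : (Formula.conj l).Realize M b v ↔ ∀ φ ∈ l, φ.Realize M b v := by
  have h : Formula.conj l = l.foldr Formula.and Formula.verum := rfl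
  rw [h]
  clear h
  induction l with
  | nil => simp [Formula.verum, Formula.neg, Formula.Realize]
  | cons φ l ih => simp [Formula.and, Formula.neg, Formula.Realize, ih]

theorem Formula.realize_disj {M : Structure} {b : M.RelValuation} {v : M.Valuation}
    (l : List Formula) : (Formula.disj l).Realize M b v ↔ ∃ φ ∈ l, φ.Realize M b v := by
  have h : Formula.disj l = l.foldr Formula.or Formula.falsum := rfl
  rw [h]
  clear h
  induction l with
  | nil => simp [Formula.Realize]
  | cons φ l ih =>
    simp only [Formula.or, Formula.neg, Formula.Realize, imp_false, List.foldr_cons, ih,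
      List.mem_cons, exists_eq_or_imp]
    exact or_iff_not_imp_left.symm

/-- Every element of sort `S` is the value of exactly one constant in `C`. -/
structure Enumerates (M : Structure) (S : ℕ) (C : List ℕ) : Prop where
  exists_const : ∀ x : M.carrier S, ∃ c ∈ C, constVal M S c = x
  const_inj : ∀ c ∈ C, ∀ c' ∈ C, constVal M S c = constVal M S c' → c = c'

theorem Structure.Models.enumerates {M : Structure} {S : ℕ} {C : List ℕ}
    (h : M.Models {edtDistinct S C, edtExhaustive S C}) : Enumerates M S C := by
  obtain ⟨v⟩ : Nonempty M.Valuation := ⟨fun s _ => (M.nonempty s).some⟩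
  have h₁ := h (edtDistinct S C) (by simp) (fun _ _ => True) v
  have h₂ := h (edtExhaustive S C) (by simp) (fun _ _ => True) v
  refine ⟨fun x => ?_, fun c hc c' hc' heq => ?_⟩
  · have := (Formula.realize_disj _).1 (h₂ x)
    simp only [List.mem_map, exists_exists_and_eq_and] at this
    obtain ⟨c, hc, hx⟩ := this
    refine ⟨c, hc, ?_⟩
    simp only [Formula.Realize, Term.eval, const_eval, Function.update_self] at hx
    exact hx.symm
  · by_contra hne
    have := (Formula.realize_conj _).1 h₁ (.neg (.eq (Term.const S c) (Term.const S c')))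
      (List.mem_map.2 ⟨(c, c'), by simp [List.mem_filter, hc, hc', hne], rfl⟩)
    simp only [Formula.neg, Formula.Realize, const_eval] at this
    exact this heq

/-! ### From models to annotations -/

/-- The truth value of a proposition, as a number. -/
noncomputable def truth (p : Prop) : ℕ := open Classical in if p then 1 else 0

theorem truth_eq_one {p : Prop} : truth p = 1 ↔ p := by
  unfold truth
  split_ifs with h <;> simp [h]

theorem truth_lt_two (p : Prop) : truth p < 2 := by
  unfold truth
  split_ifs <;> simp

theorem truth_inj {p q : Prop} (h : truth p = truth q) : p = q := by
  rw [← truth_eq_one (p := p), h, truth_eq_one]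

section Annotate

variable (M : Structure) (b : M.RelValuation) (v : M.Valuation) (h : ∀ s, M.carrier s → ℕ)

/-- The annotation of a term by its values in a structure. -/
def Term.annotate : {s : ℕ} → Term s → List (Token × ℕ)
  | _, .var s n => [(.var s n, h s (v s n))]
  | _, .app f args => (.fn f, h f.cod (M.funMap f fun i => (args i).eval M v)) ::
      (List.ofFn fun i => (args i).annotate).flatten

/-- The annotation of a formula by its truth values in a structure. -/
noncomputable def Formula.annotate : Formula → List (Token × ℕ)
  | .falsum => [(.falsum, truth False)]
  | .eq t u => (.eq, truth (t.eval M v = u.eval M v)) :: (t.annotate M v h ++ u.annotate M v h)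
  | .rel P args => (.rel P, truth (M.relMap P fun i => (args i).eval M v)) ::
      (List.ofFn fun i => (args i).annotate M v h).flatten
  | .pvar P args => (.pvar P, truth (b P fun i => (args i).eval M v)) ::
      (List.ofFn fun i => (args i).annotate M v h).flatten
  | .imp φ ψ => (.imp, truth (φ.Realize M b v → ψ.Realize M b v)) :: (φ.annotate ++ ψ.annotate)
  | .all s n φ => (.all s n, 0) :: φ.annotate

/-- The values of the subterms of a term. -/
def Term.elements : {s : ℕ} → Term s → List (Σ s, M.carrier s)
  | _, .var s n => [⟨s, v s n⟩]
  | _, .app f args => ⟨f.cod, M.funMap f fun i => (args i).eval M v⟩ ::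
      (List.ofFn fun i => (args i).elements).flatten

/-- The values of the subterms of a formula. -/
def Formula.elements : Formula → List (Σ s, M.carrier s)
  | .falsum => []
  | .eq t u => t.elements M v ++ u.elements M v
  | .rel _ args => (List.ofFn fun i => (args i).elements M v).flatten
  | .pvar _ args => (List.ofFn fun i => (args i).elements M v).flatten
  | .imp φ ψ => φ.elements ++ ψ.elements
  | .all _ _ φ => φ.elements

variable {M b v h}

theorem Term.map_fst_annotate {s : ℕ} (t : Term s) :
    (t.annotate M v h).map Prod.fst = t.encode := by
  induction t with
  | var s n => rfl
  | app f args ih =>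
    simp only [Term.annotate, Term.encode, List.map_cons, List.map_flatten, List.map_ofFn]
    congr 3
    exact funext ih

theorem map_fst_args {d : List ℕ} (args : ∀ i : Fin d.length, Term (d.get i)) :
    (List.ofFn fun i => (args i).annotate M v h).flatten.map Prod.fst =
      (List.ofFn fun i => (args i).encode).flatten := by
  simp only [List.map_flatten, List.map_ofFn]
  congr 2
  exact funext fun i => (args i).map_fst_annotate

theorem Formula.map_fst_annotate (φ : Formula) :
    (φ.annotate M b v h).map Prod.fst = φ.encode := by
  induction φ with
  | falsum => rfl
  | eq t u => simp [Formula.annotate, Formula.encode, Term.map_fst_annotate]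
  | rel P args => simp only [Formula.annotate, Formula.encode, List.map_cons, map_fst_args]
  | pvar P args => simp only [Formula.annotate, Formula.encode, List.map_cons, map_fst_args]
  | imp φ ψ ih₁ ih₂ => simp [Formula.annotate, Formula.encode, ih₁, ih₂]
  | all s n φ ih => simp [Formula.annotate, Formula.encode, ih]

theorem length_flatten_ofFn {α β : Type*} {n : ℕ} {f : Fin n → List α} {g : Fin n → List β}
    (hfg : ∀ i, (f i).length = (g i).length) :
    (List.ofFn f).flatten.length = (List.ofFn g).flatten.length := by
  simp only [List.length_flatten, List.map_ofFn]
  congr 2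
  exact funext hfg

theorem Term.length_elements {s : ℕ} (t : Term s) :
    (t.elements M v).length = t.encode.length := by
  induction t with
  | var s n => rfl
  | app f args ih => simp only [Term.elements, Term.encode, List.length_cons, length_flatten_ofFn ih]

/-- Every subterm starts at a token of its own. This bounds the number of names a guess has to
provide. -/
theorem Formula.length_elements_le (φ : Formula) :
    (φ.elements M v).length ≤ φ.encode.length := by
  induction φ with
  | falsum => simp [Formula.elements]
  | eq t u => simp [Formula.elements, Formula.encode, Term.length_elements]
  | rel P args =>
    simp only [Formula.elements, Formula.encode, List.length_cons,
      length_flatten_ofFn fun i => (args i).length_elements (v := v)]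
    exact Nat.le_succ _
  | pvar P args =>
    simp only [Formula.elements, Formula.encode, List.length_cons,
      length_flatten_ofFn fun i => (args i).length_elements (v := v)]
    exact Nat.le_succ _
  | imp φ ψ ih₁ ih₂ =>
    simp only [Formula.elements, Formula.encode, List.length_cons, List.length_append]
    omega
  | all s n φ ih =>
    simp only [Formula.elements, Formula.encode, List.length_cons]
    omega

theorem Term.eval_mem_elements {s : ℕ} (t : Term s) :
    (⟨s, t.eval M v⟩ : Σ s, M.carrier s) ∈ t.elements M v := by
  cases t <;> simp [Term.elements, Term.eval]

end Annotate

/-- Reading `g` pushes `k` on the stack and records only facts that satisfy `Q`. -/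
def Reads (Q : Fact → Prop) (g : List (Token × ℕ)) (k : List (ℕ × ℕ)) : Prop :=
  ∀ A, (run (g ++ A)).1 = k ++ (run A).1 ∧ ∀ x ∈ (run (g ++ A)).2, x ∈ (run A).2 ∨ Q x

namespace Reads

variable {Q : Fact → Prop}

theorem nil : Reads Q [] [] := fun _ => ⟨rfl, fun _ => Or.inl⟩

theorem append {g g' : List (Token × ℕ)} {k k' : List (ℕ × ℕ)} (h : Reads Q g k)
    (h' : Reads Q g' k') : Reads Q (g ++ g') (k ++ k') := by
  intro A
  rw [List.append_assoc, List.append_assoc]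
  refine ⟨by rw [(h _).1, (h' A).1], fun x hx => ?_⟩
  exact ((h _).2 x hx).elim ((h' A).2 x) Or.inr

theorem cons {g : List (Token × ℕ)} {k : List (ℕ × ℕ)} {t : Token} {a : ℕ} (h : Reads Q g k)
    (hk : k.length = t.arity) (hQ : Q (t, k, a)) : Reads Q ((t, a) :: g) [(t.kind, a)] := by
  intro A
  have hstep : run ((t, a) :: g ++ A) = runStep (t, a) (run (g ++ A)) := rfl
  -- The arguments are exactly as many as the arity, so `take` returns `k` and `drop` uncovers the
  -- old stack.
  rw [hstep, runStep, (h A).1, ← hk, List.drop_left, List.take_left]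
  refine ⟨rfl, fun x hx => ?_⟩
  rcases List.mem_cons.1 hx with rfl | hx
  · exact Or.inr hQ
  · exact (h A).2 x hx

theorem ofFn {n : ℕ} {g : Fin n → List (Token × ℕ)} {k : Fin n → ℕ × ℕ}
    (h : ∀ i, Reads Q (g i) [k i]) : Reads Q (List.ofFn g).flatten (List.ofFn k) := by
  induction n with
  | zero => simpa using nil
  | succ n ih =>
    simp only [List.ofFn_succ, List.flatten_cons]
    exact (h 0).append (ih fun i => h i.succ)

end Reads

/-- Every position leaves exactly one fact, so a bound on the values in the facts bounds the whole
annotation. -/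
theorem map_facts_run (A : List (Token × ℕ)) :
    (run A).2.map (fun x => (x.1, x.2.2)) = A := by
  induction A with
  | nil => rfl
  | cons p A ih =>
    have hstep : run (p :: A) = runStep p (run A) := rfl
    simp [hstep, runStep, ih]

/-- The facts that are recorded when the annotation of a formula by its values is read. -/
inductive TrueFact (L : Signature) (M : Structure) (b : M.RelValuation) (v : M.Valuation)
    (h : ∀ s, M.carrier s → ℕ) (E : List (Σ s, M.carrier s)) : Fact → Prop
  | var (s n : ℕ) : s ∈ L.sorts → ⟨s, v s n⟩ ∈ E →
      TrueFact L M b v h E (.var s n, [], h s (v s n))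
  | fn (f : FunSym) (args : ∀ i : Fin f.dom.length, M.carrier (f.dom.get i)) : f ∈ L.funs →
      (∀ i, ⟨_, args i⟩ ∈ E) → ⟨_, M.funMap f args⟩ ∈ E →
      TrueFact L M b v h E
        (.fn f, List.ofFn fun i => (f.dom.get i + 1, h _ (args i)), h _ (M.funMap f args))
  | rel (P : PredSym) (args : ∀ i : Fin P.dom.length, M.carrier (P.dom.get i)) : P ∈ L.preds →
      (∀ i, ⟨_, args i⟩ ∈ E) → TrueFact L M b v h E
        (.rel P, List.ofFn fun i => (P.dom.get i + 1, h _ (args i)), truth (M.relMap P args))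
  | pvar (P : PredSym) (args : ∀ i : Fin P.dom.length, M.carrier (P.dom.get i)) :
      (∀ i, ⟨_, args i⟩ ∈ E) → TrueFact L M b v h E
        (.pvar P, List.ofFn fun i => (P.dom.get i + 1, h _ (args i)), truth (b P args))
  | falsum : TrueFact L M b v h E (.falsum, [], truth False)
  | eq (s : ℕ) (x y : M.carrier s) : ⟨s, x⟩ ∈ E → ⟨s, y⟩ ∈ E →
      TrueFact L M b v h E (.eq, [(s + 1, h s x), (s + 1, h s y)], truth (x = y))
  | imp (p q : Prop) : TrueFact L M b v h E (.imp, [(0, truth p), (0, truth q)], truth (p → q))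

/-! ### The facts read off from a model pass the tests and satisfy the queries -/

section TrueFacts

variable {L L' : Signature} {M : Structure} {b : M.RelValuation} {v : M.Valuation}
  {h : ∀ s, M.carrier s → ℕ} {E : List (Σ s, M.carrier s)}

theorem mem_of_flatten_subset {α : Type*} {n : ℕ} {f : Fin n → List α} {l : List α}
    (h : (List.ofFn f).flatten ⊆ l) (i : Fin n) : f i ⊆ l := fun _ hx =>
  h (List.mem_flatten.2 ⟨f i, List.mem_ofFn.2 ⟨i, rfl⟩, hx⟩)

theorem Term.reads_annotate {s : ℕ} (t : Term s) (ht : t.Over L) (hE : t.elements M v ⊆ E) :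
    Reads (TrueFact L M b v h E) (t.annotate M v h) [(s + 1, h s (t.eval M v))] := by
  induction t with
  | var s n =>
    exact Reads.nil.cons rfl (.var s n ht (hE (by simp [Term.elements])))
  | app f args ih =>
    simp only [Term.elements, List.cons_subset] at hE
    have hsub := mem_of_flatten_subset hE.2
    exact (Reads.ofFn fun i => ih i (ht.2 i) (hsub i)).cons (by simp [Token.arity, Token.elim])
      (.fn f _ ht.1 (fun i => hsub i (args i).eval_mem_elements) hE.1)

theorem Formula.reads_annotate (φ : Formula) (hφ : φ.Over L) (hq : φ.QuantifierFree)
    (hE : φ.elements M v ⊆ E) :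
    Reads (TrueFact L M b v h E) (φ.annotate M b v h) [(0, truth (φ.Realize M b v))] := by
  induction φ with
  | falsum => exact Reads.nil.cons rfl .falsum
  | eq t u =>
    simp only [Formula.elements, List.append_subset] at hE
    exact ((t.reads_annotate hφ.1 hE.1).append (u.reads_annotate hφ.2 hE.2)).cons rfl
      (.eq _ _ _ (hE.1 t.eval_mem_elements) (hE.2 u.eval_mem_elements))
  | rel P args =>
    have hsub := mem_of_flatten_subset hE
    exact (Reads.ofFn fun i => (args i).reads_annotate (hφ.2 i) (hsub i)).cons
      (by simp [Token.arity, Token.elim])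
      (.rel P _ hφ.1 fun i => hsub i (args i).eval_mem_elements)
  | pvar P args =>
    have hsub := mem_of_flatten_subset hE
    exact (Reads.ofFn fun i => (args i).reads_annotate (hφ.2 i) (hsub i)).cons
      (by simp [Token.arity, Token.elim])
      (.pvar P _ fun i => hsub i (args i).eval_mem_elements)
  | imp φ ψ ih₁ ih₂ =>
    simp only [Formula.elements, List.append_subset] at hE
    exact ((ih₁ hφ.1 hq.1 hE.1).append (ih₂ hφ.2 hq.2 hE.2)).cons rfl (.imp _ _)
  | all s n φ => exact hq.elim

variable {S B : ℕ} {C : List ℕ}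

/-- `h` names the elements of `E` by different numbers below `B`, and the elements of the
enumerated sort by their constants. -/
structure Names (M : Structure) (S : ℕ) (C : List ℕ) (B : ℕ) (h : ∀ s, M.carrier s → ℕ)
    (E : List (Σ s, M.carrier s)) : Prop where
  inj : ∀ s (x y : M.carrier s), ⟨s, x⟩ ∈ E → ⟨s, y⟩ ∈ E → h s x = h s y → x = y
  mem : ∀ x : M.carrier S, h S x ∈ C
  const : ∀ x : M.carrier S, constVal M S (h S x) = x
  lt : ∀ s (x : M.carrier s), h s x < B

/-- Elements of the enumerated sort are named by a constant denoting them, all others by their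
position in `E`, which is injective on `E`. -/
theorem exists_names (hM : Enumerates M S C) (E : List (Σ s, M.carrier s)) {B : ℕ}
    (hB : E.length + C.sum < B) : ∃ h, Names M S C B h E := by
  classical
  choose g hgC hg using hM.exists_const
  let h : ∀ s, M.carrier s → ℕ := fun s x =>
    if hs : s = S then g (cast (congrArg M.carrier hs) x) else E.idxOf ⟨s, x⟩
  have hS : ∀ x, h S x = g x := fun x => by simp [h]
  have hne : ∀ s x, s ≠ S → h s x = E.idxOf ⟨s, x⟩ := fun s x hs => by simp [h, hs]
  refine ⟨h, ⟨fun s x y hx hy hxy => ?_, fun x => hS x ▸ hgC x, fun x => by rw [hS, hg],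
    fun s x => ?_⟩⟩
  · rcases eq_or_ne s S with rfl | hs
    · rw [hS, hS] at hxy
      rw [← hg x, hxy, hg]
    · rw [hne s x hs, hne s y hs] at hxy
      exact eq_of_heq (Sigma.mk.inj ((List.idxOf_inj hx).1 hxy)).2
  · rcases eq_or_ne s S with rfl | hs
    · rw [hS]
      have := List.le_sum_of_mem (hgC x)
      omega
    · rw [hne s x hs]
      -- An element outside `E` gets the index `E.length`, whence the strict inequality in `hB`.
      have := List.idxOf_le_length (a := (⟨s, x⟩ : Σ s, M.carrier s)) (l := E)
      omega

/-- Since `h` is injective on `E` in each sort, it can be inverted there: the variable with index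
`a` receives the element named `a`. In the enumerated sort the constants already denote the right
elements. -/
theorem Names.exists_valuation (hh : Names M S C B h E) :
    ∃ u : M.Valuation, ∀ s (x : M.carrier s), ⟨s, x⟩ ∈ E → denot M u S s (h s x) = x := by
  classical
  have : ∀ s a, ∃ y : M.carrier s, ∀ x, ⟨s, x⟩ ∈ E → h s x = a → y = x := by
    intro s a
    by_cases hx : ∃ x : M.carrier s, ⟨s, x⟩ ∈ E ∧ h s x = a
    · obtain ⟨y, hy, rfl⟩ := hx
      exact ⟨y, fun x hx hxy => hh.inj s y x hy hx hxy.symm⟩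
    · obtain ⟨y⟩ := M.nonempty s
      exact ⟨y, fun x h₁ h₂ => absurd ⟨x, h₁, h₂⟩ hx⟩
  choose u hu using this
  refine ⟨u, fun s x hx => ?_⟩
  rcases eq_or_ne s S with rfl | hs
  · rw [denot_self, hh.const]
  · rw [denot_of_ne _ _ hs]
    exact hu s _ x hx rfl

theorem TrueFact.value_lt {x : Fact} (hh : Names M S C B h E) (hB : 2 ≤ B)
    (hx : TrueFact L M b v h E x) : x.2.2 < B := by
  cases hx <;> first | exact hh.lt _ _ | exact (truth_lt_two _).trans_le hB

theorem map_fst_ofFn {d : List ℕ} (g : Fin d.length → ℕ) :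
    (List.ofFn fun i => (d.get i + 1, g i)).map Prod.fst = d.map Nat.succ := by
  refine List.ext_getElem (by simp) fun i h₁ h₂ => by simp

theorem argVal_ofFn {d : List ℕ} (g : Fin d.length → ℕ) (i : Fin d.length) :
    argVal (List.ofFn fun i => (d.get i + 1, g i)) i = g i := by
  simp [argVal]

theorem TrueFact.check {x : Fact} {mS : ℕ → Bool} {mF : FunSym → Bool} {mP : PredSym → Bool}
    (hh : Names M S C B h E) (hS : ∀ s, mS s = true ↔ s ∈ L.sorts)
    (hF : ∀ f, mF f = true ↔ f ∈ L.funs) (hP : ∀ P, mP P = true ↔ P ∈ L.preds)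
    (hx : TrueFact L M b v h E x) : x.check S C mS mF mP = true := by
  have hn : ∀ s (y : M.carrier s), nameOK S C (s + 1) (h s y) = true := by
    intro s y
    rcases eq_or_ne s S with rfl | hs
    · simp [nameOK, hh.mem]
    · simp [nameOK, hs]
  have hn₀ : ∀ a, nameOK S C 0 a = true := fun a => by simp [nameOK]
  have hargs : ∀ (d : List ℕ) (args : ∀ i : Fin d.length, M.carrier (d.get i)),
      (List.ofFn fun i => (d.get i + 1, h _ (args i))).all (fun p => nameOK S C p.1 p.2) =
        true := by
    intro d args
    simp only [List.all_eq_true, List.mem_ofFn]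
    rintro _ ⟨i, rfl⟩
    exact hn _ _
  cases hx with
  | var s n hs _ => simp [Fact.check, Token.elim, Token.kind, hn, (hS s).2 hs]
  | fn f args hf =>
    simp only [Fact.check, Token.elim, Token.kind, hn, (hF f).2 hf, map_fst_ofFn, hargs,
      decide_true, Bool.and_self]
  | rel P args hPL =>
    simp only [Fact.check, Token.elim, Token.kind, hn₀, (hP P).2 hPL, map_fst_ofFn, hargs,
      decide_true, Bool.and_self]
  | pvar P args =>
    simp only [Fact.check, Token.elim, Token.kind, hn₀, map_fst_ofFn, hargs,
      decide_true, Bool.and_self]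
  | falsum => simp [Fact.check, Token.elim, Token.kind, hn₀, truth_eq_one]
  | eq s y z hy hz =>
    -- Injectivity of the naming lets equality of elements be tested on names.
    have : h s y = h s z ↔ y = z := ⟨hh.inj s y z hy hz, fun hyz => hyz ▸ rfl⟩
    have hval : (decide (truth (y = z) = 1) == decide (argVal [(s + 1, h s y), (s + 1, h s z)] 0 =
        argVal [(s + 1, h s y), (s + 1, h s z)] 1)) = true := by
      rw [beq_iff_eq, Bool.eq_iff_iff, decide_eq_true_eq, decide_eq_true_eq, truth_eq_one]
      exact this.symm
    simp [Fact.check, Token.elim, Token.kind, hn, hn₀, hval]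
  | imp p q =>
    have hval : (decide (truth (p → q) = 1) ==
        (!decide (argVal [(0, truth p), (0, truth q)] 0 = 1) ||
          decide (argVal [(0, truth p), (0, truth q)] 1 = 1))) = true := by
      rw [beq_iff_eq, Bool.eq_iff_iff, decide_eq_true_eq, truth_eq_one, Bool.or_eq_true,
        Bool.not_eq_true', decide_eq_false_iff_not, decide_eq_true_eq]
      change _ ↔ ¬ truth p = 1 ∨ truth q = 1
      rw [truth_eq_one, truth_eq_one]
      exact imp_iff_not_or
    simp [Fact.check, Token.elim, Token.kind, hn₀, hval]

theorem Names.args_eq (hh : Names M S C B h E) {d : List ℕ}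
    {args args' : ∀ i : Fin d.length, M.carrier (d.get i)} (ha : ∀ i, ⟨_, args i⟩ ∈ E)
    (ha' : ∀ i, ⟨_, args' i⟩ ∈ E)
    (heq : (List.ofFn fun i => (d.get i + 1, h _ (args i))) =
      List.ofFn fun i => (d.get i + 1, h _ (args' i))) : args = args' := by
  have := List.ofFn_injective heq
  exact funext fun i => hh.inj _ _ _ (ha i) (ha' i) (Prod.mk.inj (congrFun this i)).2

/-- Equal names come from equal elements, and equal truth values from equivalent propositions, so
equal arguments give equal results. -/
theorem TrueFact.compat {x y : Fact} (hh : Names M S C B h E) (hx : TrueFact L M b v h E x)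
    (hy : TrueFact L M b v h E y) : x.compat y = true := by
  suffices hs : x.1 = y.1 → x.2.1 = y.2.1 → x.2.2 = y.2.2 by
    rw [Fact.compat, Bool.or_eq_true, decide_eq_true_eq, Bool.not_eq_true', Bool.eq_false_iff,
      ne_eq, Bool.and_eq_true, decide_eq_true_eq, decide_eq_true_eq]
    tauto
  intro h₁ h₂
  cases hx with
  | var s n => cases hy <;> cases h₁; rfl
  | fn f args hf ha =>
    cases hy <;> cases h₁
    rename_i args' ha' _ _
    rw [hh.args_eq ha ‹_› h₂]
  | rel P args hP ha =>
    cases hy <;> cases h₁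
    rw [hh.args_eq ha ‹_› h₂]
  | pvar P args ha =>
    cases hy <;> cases h₁
    rw [hh.args_eq ha ‹_› h₂]
  | falsum => cases hy <;> cases h₁; rfl
  | eq s x y hx hy' =>
    cases hy <;> cases h₁
    rename_i s' x' y' hx' hy''
    simp only [List.cons.injEq, Prod.mk.injEq, Nat.add_right_cancel_iff, and_true] at h₂
    obtain ⟨⟨rfl, h₂⟩, -, h₃⟩ := h₂
    rw [hh.inj _ _ _ hx hx' h₂, hh.inj _ _ _ hy' hy'' h₃]
  | imp p q =>
    cases hy <;> cases h₁
    simp only [List.cons.injEq, Prod.mk.injEq, true_and, and_true] at h₂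
    rw [truth_inj h₂.1, truth_inj h₂.2]

/-- The one structure `M` satisfies the facts about all symbols, so `L'` is arbitrary and the same
`M` and `u` answer both queries. -/
theorem TrueFact.holds {x : Fact} {u : M.Valuation}
    (hu : ∀ s (x : M.carrier s), ⟨s, x⟩ ∈ E → denot M u S s (h s x) = x)
    (hx : TrueFact L M b v h E x) : x.Holds L' S M u := by
  cases hx with
  | fn f args _ ha hfa =>
    refine ⟨?_, by simp⟩
    rintro _ ⟨⟩ -
    simp only [argVal_ofFn, hu _ _ (ha _), hu _ _ hfa]
  | rel P args _ ha =>
    refine ⟨by simp, ?_⟩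
    rintro _ ⟨⟩ -
    simp only [argVal_ofFn, hu _ _ (ha _), truth_eq_one]
  | _ => exact ⟨by simp, by simp⟩

theorem TrueFact.exists_out {x : Fact} {s : ℕ} (hx : TrueFact L M b v h E x)
    (hs : x.out.1 = s + 1) : ∃ y : M.carrier s, ⟨s, y⟩ ∈ E ∧ x.out.2 = h s y := by
  cases hx with
  | var s' n hs' hE =>
    obtain rfl : s' = s := Nat.succ.inj hs
    exact ⟨_, hE, rfl⟩
  | fn f args hf ha hE =>
    obtain rfl : f.cod = s := Nat.succ.inj hs
    exact ⟨_, hE, rfl⟩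
  | _ => cases hs

theorem TrueFact.separates {x y : Fact} {u : M.Valuation}
    (hu : ∀ s (x : M.carrier s), ⟨s, x⟩ ∈ E → denot M u S s (h s x) = x)
    (hx : TrueFact L M b v h E x) (hy : TrueFact L M b v h E y) : x.Separates L' S y M u := by
  intro s hxs hys _ _ hne heq
  obtain ⟨a, ha, hxa⟩ := hx.exists_out hxs
  obtain ⟨c, hc, hyc⟩ := hy.exists_out hys
  rw [hxa, hyc, hu s a ha, hu s c hc] at heq
  exact hne (by rw [hxa, hyc, heq])

end TrueFacts

/-! ### Gluing two structures -/

/-- `e` is an isomorphism between the reducts of two structures to `L`. -/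
structure ReductIso (L : Signature) (M N : Structure) (e : ∀ s, M.carrier s → N.carrier s) :
    Prop where
  bij : ∀ s ∈ L.sorts, Function.Bijective (e s)
  map_fun : ∀ f ∈ L.funs, ∀ args, e _ (M.funMap f args) = N.funMap f fun i => e _ (args i)
  map_rel : ∀ P ∈ L.preds, ∀ args, M.relMap P args ↔ N.relMap P fun i => e _ (args i)

namespace ReductIso

variable {L : Signature} {M N : Structure} {e : ∀ s, M.carrier s → N.carrier s}

theorem eval (he : ReductIso L M N e) (v : M.Valuation) {s : ℕ} (t : Term s) (ht : t.Over L) :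
    e s (t.eval M v) = t.eval N fun s n => e s (v s n) := by
  induction t with
  | var s n => rfl
  | app f args ih =>
    rw [Term.eval, he.map_fun f ht.1, Term.eval]
    congr 1
    exact funext fun i => ih i (ht.2 i)

theorem _root_.ManySorted.Term.Over.mem_sorts {s : ℕ} {t : Term s} (ht : t.Over L) :
    s ∈ L.sorts := by
  cases t with
  | var s n => exact ht
  | app f args => exact L.cod_mem f ht.1

/-- Isomorphism invariance, for formulas without predicate variables, since `b` and `b'` are
unrelated. Equality uses that `e` is injective on the sorts of `L`, quantification that it is
surjective. -/
theorem realize (he : ReductIso L M N e) (b : M.RelValuation) (b' : N.RelValuation)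
    (φ : Formula) (hφ : φ.Over L) (hp : φ.NoPredVar) (v : M.Valuation) :
    φ.Realize M b v ↔ φ.Realize N b' fun s n => e s (v s n) := by
  induction φ generalizing v with
  | falsum => rfl
  | @eq s t u =>
    simp only [Formula.Realize, ← he.eval v t hφ.1, ← he.eval v u hφ.2]
    exact ((he.bij s hφ.1.mem_sorts).1.eq_iff).symm
  | rel P args =>
    simp only [Formula.Realize, he.map_rel P hφ.1, he.eval v _ (hφ.2 _)]
  | pvar P args => exact hp.elim
  | imp φ ψ ih₁ ih₂ =>
    simp only [Formula.Realize, ih₁ hφ.1 hp.1 v, ih₂ hφ.2 hp.2 v]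
  | all s n φ ih =>
    simp only [Formula.Realize, ih hφ.2 hp]
    have hupd : ∀ x : M.carrier s,
        (fun r k => e r (Function.update v s (Function.update (v s) n x) r k)) =
          Function.update (fun r k => e r (v r k)) s
            (Function.update (fun k => e s (v s k)) n (e s x)) := by
      intro x
      funext r k
      rcases eq_or_ne r s with rfl | hr
      · rcases eq_or_ne k n with rfl | hk
        · simp
        · simp [hk]
      · simp [hr]
    simp only [hupd]
    exact ⟨fun hall y => by
      obtain ⟨x, rfl⟩ := (he.bij s hφ.1).2 y
      exact hall x, fun hall x => hall _⟩

theorem models (he : ReductIso L M N e) {T : Set Formula} (hT : IsTheory L T)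
    (hN : N.Models T) : M.Models T := fun φ hφ b v =>
  (he.realize b (fun _ _ => True) φ (hT φ hφ).1 (hT φ hφ).2.2 v).2 (hN φ hφ _ _)

end ReductIso

section Glue

variable {L₁ L₂ : Signature} {S : ℕ} {C : List ℕ}

/-- Both structures enumerate the sort `S` by the same constants, so one carrier serves for both.
Any other sort takes its carrier from a signature that contains it; the map to the other structure
is constant and carries no information. -/
theorem exists_glued_carrier {M₁ M₂ : Structure} (hM₁ : Enumerates M₁ S C)
    (hM₂ : Enumerates M₂ S C) (hsorts : ∀ s ∈ L₁.sorts, s ∈ L₂.sorts → s = S) (s : ℕ) :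
    ∃ (X : Type) (e₁ : X → M₁.carrier s) (e₂ : X → M₂.carrier s), Nonempty X ∧
      (s ∈ L₁.sorts → Function.Bijective e₁) ∧ (s ∈ L₂.sorts → Function.Bijective e₂) ∧
      (s = S → ∀ c ∈ C, ∀ (u₁ : M₁.Valuation) (u₂ : M₂.Valuation),
        ∃ x, e₁ x = denot M₁ u₁ S s c ∧ e₂ x = denot M₂ u₂ S s c) := by
  rcases eq_or_ne s S with rfl | hs
  · choose g hgC hg using hM₁.exists_const
    have hgc : ∀ c ∈ C, g (constVal M₁ s c) = c := fun c hc =>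
      hM₁.const_inj _ (hgC _) _ hc (hg _)
    -- The second map sends the value of a constant in `M₁` to the value of the same constant in
    -- `M₂`.
    refine ⟨M₁.carrier s, id, fun x => constVal M₂ s (g x), M₁.nonempty s,
      fun _ => Function.bijective_id, fun _ => ⟨fun x y hxy => ?_, fun y => ?_⟩,
      fun _ c hc u₁ u₂ => ⟨constVal M₁ s c, ?_, ?_⟩⟩
    · rw [← hg x, hM₂.const_inj _ (hgC x) _ (hgC y) hxy, hg y]
    · obtain ⟨c, hc, rfl⟩ := hM₂.exists_const y
      exact ⟨constVal M₁ s c, congrArg (constVal M₂ s) (hgc c hc)⟩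
    · rw [denot_self, id]
    · rw [denot_self]
      exact congrArg (constVal M₂ s) (hgc c hc)
  · obtain ⟨x₁⟩ := M₁.nonempty s
    obtain ⟨x₂⟩ := M₂.nonempty s
    by_cases h₁ : s ∈ L₁.sorts
    · exact ⟨M₁.carrier s, id, fun _ => x₂, ⟨x₁⟩, fun _ => Function.bijective_id,
        fun h₂ => absurd (hsorts s h₁ h₂) hs, fun h => absurd h hs⟩
    · exact ⟨M₂.carrier s, fun _ => x₁, id, ⟨x₂⟩, fun h => absurd h h₁,
        fun _ => Function.bijective_id, fun h => absurd h hs⟩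

/-- Two structures that agree on the enumerated sort are reducts of one structure. -/
theorem exists_glued_structure {M₁ M₂ : Structure} (hM₁ : Enumerates M₁ S C)
    (hM₂ : Enumerates M₂ S C) (hsorts : ∀ s ∈ L₁.sorts, s ∈ L₂.sorts → s = S)
    (hfuns : ∀ f ∈ L₁.funs, f ∈ L₂.funs → ∃ c ∈ C, f = ⟨c, [], S⟩)
    (hpreds : ∀ P ∈ L₁.preds, P ∉ L₂.preds) (u₁ : M₁.Valuation) (u₂ : M₂.Valuation) :
    ∃ (M : Structure) (e₁ : ∀ s, M.carrier s → M₁.carrier s)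
      (e₂ : ∀ s, M.carrier s → M₂.carrier s) (val : ∀ s, ℕ → M.carrier s),
      ReductIso L₁ M M₁ e₁ ∧ ReductIso L₂ M M₂ e₂ ∧
      ∀ s a, (s = S → a ∈ C) → (s ∈ L₁.sorts → e₁ s (val s a) = denot M₁ u₁ S s a) ∧
        (s ∈ L₂.sorts → e₂ s (val s a) = denot M₂ u₂ S s a) := by
  choose X e₁ e₂ hX hb₁ hb₂ hc using exists_glued_carrier (L₁ := L₁) (L₂ := L₂) hM₁ hM₂ hsorts
  have hfun : ∀ (f : FunSym) (args : ∀ i : Fin f.dom.length, X (f.dom.get i)), ∃ y : X f.cod,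
      (f ∈ L₁.funs → e₁ _ y = M₁.funMap f fun i => e₁ _ (args i)) ∧
      (f ∈ L₂.funs → e₂ _ y = M₂.funMap f fun i => e₂ _ (args i)) := by
    intro f args
    by_cases h₁ : f ∈ L₁.funs
    · by_cases h₂ : f ∈ L₂.funs
      -- A shared function symbol is one of the constants, whose two values correspond to one common
      -- point.
      · obtain ⟨c, hcC, rfl⟩ := hfuns f h₁ h₂
        obtain ⟨x, hx₁, hx₂⟩ := hc S rfl c hcC u₁ u₂
        refine ⟨x, fun _ => ?_, fun _ => ?_⟩
        · rw [funMap_const]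
          exact hx₁.trans (denot_self _ _ _ _)
        · rw [funMap_const]
          exact hx₂.trans (denot_self _ _ _ _)
      -- An unshared symbol is pulled back along the bijection on its result sort.
      · obtain ⟨y, hy⟩ := (hb₁ _ (L₁.cod_mem f h₁)).2 (M₁.funMap f fun i => e₁ _ (args i))
        exact ⟨y, fun _ => hy, fun h => absurd h h₂⟩
    · by_cases h₂ : f ∈ L₂.funs
      · obtain ⟨y, hy⟩ := (hb₂ _ (L₂.cod_mem f h₂)).2 (M₂.funMap f fun i => e₂ _ (args i))
        exact ⟨y, fun h => absurd h h₁, fun _ => hy⟩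
      · exact ⟨(hX _).some, fun h => absurd h h₁, fun h => absurd h h₂⟩
  have hval : ∀ s a, ∃ x : X s, (s = S → a ∈ C) →
      (s ∈ L₁.sorts → e₁ s x = denot M₁ u₁ S s a) ∧
        (s ∈ L₂.sorts → e₂ s x = denot M₂ u₂ S s a) := by
    intro s a
    by_cases hs : s = S
    · by_cases ha : a ∈ C
      · obtain ⟨x, hx₁, hx₂⟩ := hc s hs a ha u₁ u₂
        exact ⟨x, fun _ => ⟨fun _ => hx₁, fun _ => hx₂⟩⟩
      · exact ⟨(hX s).some, fun h => absurd (h hs) ha⟩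
    · by_cases h₁ : s ∈ L₁.sorts
      · obtain ⟨x, hx⟩ := (hb₁ s h₁).2 (denot M₁ u₁ S s a)
        exact ⟨x, fun _ => ⟨fun _ => hx, fun h₂ => absurd (hsorts s h₁ h₂) hs⟩⟩
      · by_cases h₂ : s ∈ L₂.sorts
        · obtain ⟨x, hx⟩ := (hb₂ s h₂).2 (denot M₂ u₂ S s a)
          exact ⟨x, fun _ => ⟨fun h => absurd h h₁, fun _ => hx⟩⟩
        · exact ⟨(hX s).some, fun _ => ⟨fun h => absurd h h₁, fun h => absurd h h₂⟩⟩
  choose F hF₁ hF₂ using hfun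
  choose val hval using hval
  -- No predicate symbol is shared, so for each symbol of a signature only one of the two disjuncts
  -- can apply.
  refine ⟨⟨X, hX, F, fun P args => (P ∈ L₁.preds ∧ M₁.relMap P fun i => e₁ _ (args i)) ∨
    (P ∈ L₂.preds ∧ M₂.relMap P fun i => e₂ _ (args i))⟩, e₁, e₂, val,
    ⟨hb₁, fun f hf args => hF₁ f args hf, fun P hP args => ?_⟩,
    ⟨hb₂, fun f hf args => hF₂ f args hf, fun P hP args => ?_⟩, hval⟩
  · simp [hP, hpreds P hP]
  · have : P ∉ L₁.preds := fun h => hpreds P h hP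
    simp [hP, this]

end Glue

/-! ### From annotations to models -/

/-- Stack entries are results of earlier facts. The queries separate only such results, so this
extends separation, and the checks on names and sorts, to all arguments. -/
theorem out_of_run (A : List (Token × ℕ)) :
    (∀ p ∈ (run A).1, ∃ x ∈ (run A).2, x.out = p) ∧
      ∀ x ∈ (run A).2, ∀ p ∈ x.2.1, ∃ y ∈ (run A).2, y.out = p := by
  induction A with
  | nil => simp [run]
  | cons q A ih =>
    have hstep : run (q :: A) = runStep q (run A) := rfl
    rw [hstep, runStep]
    have hold : ∀ p ∈ (run A).1, ∃ x ∈ (q.1, (run A).1.take q.1.arity, q.2) :: (run A).2,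
        Fact.out x = p := fun p hp =>
      (ih.1 p hp).imp fun x hx => ⟨List.mem_cons_of_mem _ hx.1, hx.2⟩
    refine ⟨fun p hp => ?_, fun x hx p hp => ?_⟩
    · rcases List.mem_cons.1 hp with rfl | hp
      · exact ⟨_, List.mem_cons_self, rfl⟩
      · exact hold p (List.mem_of_mem_drop hp)
    · rcases List.mem_cons.1 hx with rfl | hx
      · exact hold p (List.mem_of_mem_take hp)
      · exact (ih.2 x hx p hp).imp fun y hy => ⟨List.mem_cons_of_mem _ hy.1, hy.2⟩

/-- All facts of `F` hold in the structure when the name `a` of sort `s` denotes `val s a`. -/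
structure Interprets (L : Signature) (M : Structure) (b : M.RelValuation) (v : M.Valuation)
    (val : ∀ s, ℕ → M.carrier s) (F : List Fact) : Prop where
  var : ∀ s n a, (.var s n, [], a) ∈ F → s ∈ L.sorts ∧ v s n = val s a
  fn : ∀ f args a, (.fn f, args, a) ∈ F → f ∈ L.funs ∧
    args.map Prod.fst = f.dom.map Nat.succ ∧
    M.funMap f (fun i => val (f.dom.get i) (argVal args i)) = val f.cod a
  rel : ∀ P args a, (.rel P, args, a) ∈ F → P ∈ L.preds ∧
    args.map Prod.fst = P.dom.map Nat.succ ∧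
    (M.relMap P (fun i => val (P.dom.get i) (argVal args i)) ↔ a = 1)
  pvar : ∀ P args a, (.pvar P, args, a) ∈ F → args.map Prod.fst = P.dom.map Nat.succ ∧
    (b P (fun i => val (P.dom.get i) (argVal args i)) ↔ a = 1)
  falsum : ∀ args a, (.falsum, args, a) ∈ F → a ≠ 1
  eq : ∀ args a, (.eq, args, a) ∈ F → ∃ s x y, args = [(s + 1, x), (s + 1, y)] ∧
    (val s x = val s y ↔ a = 1)
  imp : ∀ args a, (.imp, args, a) ∈ F → ∃ x y, args = [(0, x), (0, y)] ∧
    ((x = 1 → y = 1) ↔ a = 1)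
  all : ∀ s n args a, (.all s n, args, a) ∉ F

/-! ### Recovering a formula from an annotated string -/

section Parse

variable {L : Signature} {M : Structure} {b : M.RelValuation} {v : M.Valuation}
  {val : ∀ s, ℕ → M.carrier s} {F : List Fact}

/-- The string is an expression of kind `p.1` whose value is named by `p.2`. -/
def Represents (L : Signature) (M : Structure) (b : M.RelValuation) (v : M.Valuation)
    (val : ∀ s, ℕ → M.carrier s) (w : List Token) (p : ℕ × ℕ) : Prop :=
  (p.1 = 0 ∧ ∃ φ : Formula, φ.encode = w ∧ φ.Over L ∧ φ.QuantifierFree ∧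
    (φ.Realize M b v ↔ p.2 = 1)) ∨
  ∃ s, p.1 = s + 1 ∧ ∃ t : Term s, t.encode = w ∧ t.Over L ∧ t.eval M v = val s p.2

theorem Represents.formula {w : List Token} {a : ℕ} (h : Represents L M b v val w (0, a)) :
    ∃ φ : Formula, φ.encode = w ∧ φ.Over L ∧ φ.QuantifierFree ∧ (φ.Realize M b v ↔ a = 1) := by
  rcases h with ⟨-, h⟩ | ⟨s, hs, -⟩
  · exact h
  · cases hs

theorem Represents.term {w : List Token} {s a : ℕ}
    (h : Represents L M b v val w (s + 1, a)) :
    ∃ t : Term s, t.encode = w ∧ t.Over L ∧ t.eval M v = val s a := by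
  rcases h with ⟨h, -⟩ | ⟨s', hs, h⟩
  · cases h
  · obtain rfl : s = s' := Nat.succ.inj hs
    exact h

theorem exists_args {d : List ℕ} {args : List (ℕ × ℕ)} {xs : List (List Token)}
    (h : List.Forall₂ (Represents L M b v val) xs args)
    (hk : args.map Prod.fst = d.map Nat.succ) :
    ∃ ts : ∀ i : Fin d.length, Term (d.get i),
      (List.ofFn fun i => (ts i).encode).flatten = xs.flatten ∧ (∀ i, (ts i).Over L) ∧
      ∀ i, (ts i).eval M v = val (d.get i) (argVal args i) := by
  have hlen : args.length = d.length := by simpa using congrArg List.length hk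
  have hlx : xs.length = d.length := h.length_eq.trans hlen
  have key : ∀ i : Fin d.length, ∃ t : Term (d.get i),
      t.encode = xs[(i : ℕ)]'(lt_of_lt_of_eq i.2 hlx.symm) ∧ t.Over L ∧
      t.eval M v = val (d.get i) (argVal args i) := by
    intro i
    obtain ⟨hi, heq⟩ := argVal_eq hk i
    have := h.get (lt_of_lt_of_eq i.2 hlx.symm) hi
    simp only [List.get_eq_getElem] at this
    rw [show args[(i : ℕ)] = (d.get i + 1, argVal args i) from heq] at this
    exact this.term
  choose ts h₁ h₂ h₃ using key
  refine ⟨ts, congrArg _ (List.ext_getElem (by simp [hlx]) fun i hi hi' => ?_), h₂, h₃⟩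
  simp [h₁]

/-- The string splits into consecutive expressions, one for each stack entry. A new token absorbs
the first `t.arity` of them, and `hF` says that they have the right kinds and that the value is
correct. -/
theorem Interprets.parse (hF : Interprets L M b v val F) (A : List (Token × ℕ))
    (hA : (run A).2 ⊆ F) : ∃ xs : List (List Token), A.map Prod.fst = xs.flatten ∧
      List.Forall₂ (Represents L M b v val) xs (run A).1 := by
  induction A with
  | nil => exact ⟨[], rfl, .nil⟩
  | cons q A ih =>
    have hstep : run (q :: A) = runStep q (run A) := rfl
    obtain ⟨t, a⟩ := q
    rw [hstep, runStep] at hA ⊢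
    simp only [List.cons_subset] at hA
    obtain ⟨hfact, hA⟩ := hA
    obtain ⟨xs, hxs, hrep⟩ := ih hA
    have htake := List.forall₂_take t.arity hrep
    have hdrop := List.forall₂_drop t.arity hrep
    suffices hs : Represents L M b v val (t :: (xs.take t.arity).flatten) (t.kind, a) by
      refine ⟨(t :: (xs.take t.arity).flatten) :: xs.drop t.arity, ?_, .cons hs hdrop⟩
      simp only [List.map_cons, hxs, List.flatten_cons, List.cons_append]
      rw [← List.flatten_append, List.take_append_drop]
    generalize (run A).1.take t.arity = args at hfact htake
    generalize hys : xs.take t.arity = ys at htake ⊢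
    cases t with
    | var s n =>
      obtain rfl : ys = [] := by simpa [Token.arity, Token.elim] using hys.symm
      cases htake
      obtain ⟨hs, hv⟩ := hF.var s n a hfact
      exact .inr ⟨s, rfl, .var s n, rfl, hs, hv⟩
    | fn f =>
      obtain ⟨hf, hk, hval⟩ := hF.fn f args a hfact
      obtain ⟨ts, h₁, h₂, h₃⟩ := exists_args htake hk
      refine .inr ⟨f.cod, rfl, .app f ts, by rw [Term.encode, h₁], ⟨hf, h₂⟩, ?_⟩
      rw [Term.eval]
      simpa only [h₃] using hval
    | rel P =>
      obtain ⟨hP, hk, hval⟩ := hF.rel P args a hfact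
      obtain ⟨ts, h₁, h₂, h₃⟩ := exists_args htake hk
      refine .inl ⟨rfl, .rel P ts, by rw [Formula.encode, h₁], ⟨hP, h₂⟩, trivial, ?_⟩
      rw [Formula.Realize]
      simpa only [h₃] using hval
    | pvar P =>
      obtain ⟨hk, hval⟩ := hF.pvar P args a hfact
      obtain ⟨ts, h₁, h₂, h₃⟩ := exists_args htake hk
      refine .inl ⟨rfl, .pvar P ts, by rw [Formula.encode, h₁], ⟨fun s hs => ?_, h₂⟩, trivial, ?_⟩
      · obtain ⟨i, rfl⟩ := List.mem_iff_get.1 hs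
        exact (h₂ i).mem_sorts
      · rw [Formula.Realize]
        simpa only [h₃] using hval
    | falsum =>
      obtain rfl : ys = [] := by simpa [Token.arity, Token.elim] using hys.symm
      exact .inl ⟨rfl, .falsum, rfl, trivial, trivial, by
        simp [Formula.Realize, hF.falsum args a hfact]⟩
    | eq =>
      obtain ⟨s, x, y, rfl, hval⟩ := hF.eq args a hfact
      obtain ⟨_, _, ht, hrest, rfl⟩ := List.forall₂_cons_right_iff.1 htake
      obtain ⟨_, _, hu, hnil, rfl⟩ := List.forall₂_cons_right_iff.1 hrest
      cases hnil
      obtain ⟨t, rfl, ht₁, ht₂⟩ := ht.term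
      obtain ⟨u, rfl, hu₁, hu₂⟩ := hu.term
      exact .inl ⟨rfl, .eq t u, by simp [Formula.encode], ⟨ht₁, hu₁⟩, trivial, by
        rw [Formula.Realize, ht₂, hu₂, hval]⟩
    | imp =>
      obtain ⟨x, y, rfl, hval⟩ := hF.imp args a hfact
      obtain ⟨_, _, hφ, hrest, rfl⟩ := List.forall₂_cons_right_iff.1 htake
      obtain ⟨_, _, hψ, hnil, rfl⟩ := List.forall₂_cons_right_iff.1 hrest
      cases hnil
      obtain ⟨φ, rfl, hφ₁, hφ₂, hφ₃⟩ := hφ.formula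
      obtain ⟨ψ, rfl, hψ₁, hψ₂, hψ₃⟩ := hψ.formula
      exact .inl ⟨rfl, .imp φ ψ, by simp [Formula.encode], ⟨hφ₁, hψ₁⟩, ⟨hφ₂, hψ₂⟩, by
        rw [Formula.Realize, hφ₃, hψ₃, hval]⟩
    | all s n => exact absurd hfact (hF.all s n args a)

end Parse

/-! ### Correctness and computability of the decision procedure -/

section Decide

variable {L₁ L₂ : Signature} {S : ℕ} {C : List ℕ} {mS : ℕ → Bool} {mF : FunSym → Bool}
  {mP : PredSym → Bool} {F : List Fact}

theorem argVal_ext {d : List ℕ} {args args' : List (ℕ × ℕ)}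
    (h : args.map Prod.fst = d.map Nat.succ) (h' : args'.map Prod.fst = d.map Nat.succ)
    (hv : ∀ i : Fin d.length, argVal args i = argVal args' i) : args = args' := by
  have hlen : args.length = d.length := by simpa using congrArg List.length h
  have hlen' : args'.length = d.length := by simpa using congrArg List.length h'
  refine List.ext_getElem (hlen.trans hlen'.symm) fun i h₁ h₂ => ?_
  obtain ⟨_, e₁⟩ := argVal_eq h ⟨i, lt_of_lt_of_eq h₁ hlen⟩
  obtain ⟨_, e₂⟩ := argVal_eq h' ⟨i, lt_of_lt_of_eq h₁ hlen⟩
  exact e₁.trans ((by rw [hv]) : _ = _) |>.trans e₂.symm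

theorem Fact.eq_of_compat {t : Token} {args : List (ℕ × ℕ)} {a a' : ℕ}
    (h : Fact.compat (t, args, a) (t, args, a') = true) : a = a' := by
  simpa [Fact.compat] using h

/-- A function or predicate fact holds in the glued structure because it holds in the structure
whose signature owns the symbol. Equality and predicate variables need in addition that `val` is
injective on the names in use, which holds by separation or, in the enumerated sort, by distinctness
of the constants. -/
theorem exists_interprets (hS : ∀ s, mS s = true ↔ s ∈ (L₁ ∪ L₂).sorts)
    (hF : ∀ f, mF f = true ↔ f ∈ (L₁ ∪ L₂).funs) (hP : ∀ P, mP P = true ↔ P ∈ (L₁ ∪ L₂).preds)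
    (hS₁ : S ∈ L₁.sorts) (hcheck : ∀ x ∈ F, x.check S C mS mF mP = true)
    (hcompat : ∀ x ∈ F, ∀ y ∈ F, x.compat y = true)
    (hout : ∀ x ∈ F, ∀ p ∈ x.2.1, ∃ y ∈ F, y.out = p)
    {M M₁ M₂ : Structure} {u₁ : M₁.Valuation} {u₂ : M₂.Valuation} (hM₁ : Enumerates M₁ S C)
    {e₁ : ∀ s, M.carrier s → M₁.carrier s} {e₂ : ∀ s, M.carrier s → M₂.carrier s}
    {val : ∀ s, ℕ → M.carrier s} (he₁ : ReductIso L₁ M M₁ e₁) (he₂ : ReductIso L₂ M M₂ e₂)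
    (hval : ∀ s a, (s = S → a ∈ C) → (s ∈ L₁.sorts → e₁ s (val s a) = denot M₁ u₁ S s a) ∧
        (s ∈ L₂.sorts → e₂ s (val s a) = denot M₂ u₂ S s a))
    (holds₁ : ∀ x ∈ F, x.Holds L₁ S M₁ u₁) (holds₂ : ∀ x ∈ F, x.Holds L₂ S M₂ u₂)
    (hsep₁ : ∀ x ∈ F, ∀ y ∈ F, x.Separates L₁ S y M₁ u₁)
    (hsep₂ : ∀ x ∈ F, ∀ y ∈ F, x.Separates L₂ S y M₂ u₂) :
    ∃ (b : M.RelValuation) (v : M.Valuation), Interprets (L₁ ∪ L₂) M b v val F := by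
  have hsort : ∀ x ∈ F, ∀ s, x.out.1 = s + 1 → s ∈ (L₁ ∪ L₂).sorts := by
    rintro ⟨t, args, a⟩ hx s hs
    have hc := hcheck _ hx
    cases t with
    | var s' n =>
      obtain rfl : s' = s := Nat.succ.inj hs
      simp only [Fact.check, Token.elim, Bool.and_eq_true] at hc
      exact (hS _).1 hc.2
    | fn f =>
      obtain rfl : f.cod = s := Nat.succ.inj hs
      simp only [Fact.check, Token.elim, Bool.and_eq_true] at hc
      exact (L₁ ∪ L₂).cod_mem f ((hF _).1 hc.2.1)
    | _ => cases hs
  have hname : ∀ x ∈ F, ∀ s, x.out.1 = s + 1 → s = S → x.out.2 ∈ C := by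
    intro x hx s hs hsS
    exact (Fact.check_names (hcheck x hx)).2 (hsS ▸ hs)
  have hinj : ∀ s, ∀ x ∈ F, ∀ y ∈ F, x.out.1 = s + 1 → y.out.1 = s + 1 →
      val s x.out.2 = val s y.out.2 → x.out.2 = y.out.2 := by
    intro s x hx y hy hxs hys heq
    have hvx := hval s x.out.2 (hname x hx s hxs)
    have hvy := hval s y.out.2 (hname y hy s hys)
    rcases eq_or_ne s S with rfl | hs
    · refine hM₁.const_inj _ (hname x hx s hxs rfl) _ (hname y hy s hys rfl) ?_
      rw [← denot_self M₁ u₁, ← denot_self M₁ u₁, ← hvx.1 hS₁, heq, hvy.1 hS₁]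
    · by_contra hne
      rcases hsort x hx s hxs with h | h
      · refine hsep₁ x hx y hy s hxs hys hs h hne ?_
        rw [← hvx.1 h, heq, hvy.1 h]
      · refine hsep₂ x hx y hy s hxs hys hs h hne ?_
        rw [← hvx.2 h, heq, hvy.2 h]
  have hargOut : ∀ (t : Token) (d : List ℕ) (args : List (ℕ × ℕ)) (a : ℕ), (t, args, a) ∈ F →
      args.map Prod.fst = d.map Nat.succ → ∀ i : Fin d.length,
        ∃ y ∈ F, y.out = (d.get i + 1, argVal args i) := by
    intro t d args a hx hk i
    obtain ⟨hi, heq⟩ := argVal_eq hk i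
    exact heq ▸ hout _ hx _ (List.getElem_mem hi)
  have hargVal : ∀ (t : Token) (d : List ℕ) (args : List (ℕ × ℕ)) (a : ℕ), (t, args, a) ∈ F →
      args.map Prod.fst = d.map Nat.succ → ∀ i : Fin d.length,
        (d.get i ∈ L₁.sorts →
          e₁ _ (val (d.get i) (argVal args i)) = denot M₁ u₁ S (d.get i) (argVal args i)) ∧
        (d.get i ∈ L₂.sorts →
          e₂ _ (val (d.get i) (argVal args i)) = denot M₂ u₂ S (d.get i) (argVal args i)) := by
    intro t d args a hx hk i
    obtain ⟨y, hy, hyo⟩ := hargOut t d args a hx hk i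
    refine hval _ _ fun h => ?_
    have := hname y hy (d.get i) (by rw [hyo]) h
    rwa [hyo] at this
  classical
  -- All occurrences of a variable carry the same name by `hcompat`; a variable that does not occur
  -- gets an arbitrary value.
  have hv : ∀ s n, ∃ x : M.carrier s, ∀ a, (Token.var s n, [], a) ∈ F → x = val s a := by
    intro s n
    by_cases h : ∃ a, (Token.var s n, [], a) ∈ F
    · obtain ⟨a, ha⟩ := h
      refine ⟨val s a, fun a' ha' => ?_⟩
      rw [Fact.eq_of_compat (hcompat _ ha _ ha')]
    · exact ⟨(M.nonempty s).some, fun a ha => absurd ⟨a, ha⟩ h⟩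
  choose v hv using hv
  -- A predicate variable is interpreted by the smallest relation containing the tuples recorded as
  -- true.
  refine ⟨fun P xs => ∃ args, (.pvar P, args, 1) ∈ F ∧ args.map Prod.fst = P.dom.map Nat.succ ∧
    xs = fun i => val (P.dom.get i) (argVal args i), v, ?_⟩
  constructor
  · intro s n a hx
    exact ⟨hsort _ hx s rfl, hv s n a hx⟩
  · intro f args a hx
    have hc := hcheck _ hx
    simp only [Fact.check, Token.elim, Bool.and_eq_true, decide_eq_true_eq] at hc
    have hf := (hF f).1 hc.2.1
    have hk := hc.2.2
    refine ⟨hf, hk, ?_⟩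
    have harg := hargVal _ _ _ _ hx hk
    have hres := hval f.cod a (hname _ hx f.cod rfl)
    rcases hf with hf | hf
    · apply (he₁.bij _ (L₁.cod_mem f hf)).1
      rw [he₁.map_fun f hf, hres.1 (L₁.cod_mem f hf), ← (holds₁ _ hx).1 f rfl hf]
      congr 1
      exact funext fun i => (harg i).1 (L₁.dom_mem f hf _ (List.get_mem _ _))
    · apply (he₂.bij _ (L₂.cod_mem f hf)).1
      rw [he₂.map_fun f hf, hres.2 (L₂.cod_mem f hf), ← (holds₂ _ hx).1 f rfl hf]
      congr 1
      exact funext fun i => (harg i).2 (L₂.dom_mem f hf _ (List.get_mem _ _))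
  · intro P args a hx
    have hc := hcheck _ hx
    simp only [Fact.check, Token.elim, Bool.and_eq_true, decide_eq_true_eq] at hc
    have hPL := (hP P).1 hc.2.1
    have hk := hc.2.2
    refine ⟨hPL, hk, ?_⟩
    have harg := hargVal _ _ _ _ hx hk
    rcases hPL with hPL | hPL
    · rw [he₁.map_rel P hPL, ← (holds₁ _ hx).2 P rfl hPL]
      have : (fun i => e₁ _ (val (P.dom.get i) (argVal args i))) = fun i =>
          denot M₁ u₁ S (P.dom.get i) (argVal args i) :=
        funext fun i => (harg i).1 (L₁.pdom_mem P hPL _ (List.get_mem _ _))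
      rw [this]
    · rw [he₂.map_rel P hPL, ← (holds₂ _ hx).2 P rfl hPL]
      have : (fun i => e₂ _ (val (P.dom.get i) (argVal args i))) = fun i =>
          denot M₂ u₂ S (P.dom.get i) (argVal args i) :=
        funext fun i => (harg i).2 (L₂.pdom_mem P hPL _ (List.get_mem _ _))
      rw [this]
  · intro P args a hx
    have hc := hcheck _ hx
    simp only [Fact.check, Token.elim, Bool.and_eq_true, decide_eq_true_eq] at hc
    have hk := hc.2
    refine ⟨hk, ?_, fun ha => ⟨args, ha ▸ hx, hk, rfl⟩⟩
    rintro ⟨args', hx', hk', heq⟩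
    -- A recorded tuple must not coincide with one recorded as true under other names: injectivity
    -- identifies the names, then compatibility the values.
    obtain rfl : args = args' := by
      refine argVal_ext hk hk' fun i => ?_
      obtain ⟨y, hy, hyo⟩ := hargOut _ _ _ _ hx hk i
      obtain ⟨z, hz, hzo⟩ := hargOut _ _ _ _ hx' hk' i
      have := hinj (P.dom.get i) y hy z hz (by rw [hyo]) (by rw [hzo])
      rw [hyo, hzo] at this
      exact this (congrFun heq i)
    exact Fact.eq_of_compat (hcompat _ hx _ hx')
  · intro args a hx
    have hc := hcheck _ hx
    simp only [Fact.check, Token.elim, Bool.and_eq_true, Bool.not_eq_true',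
      decide_eq_false_iff_not] at hc
    exact hc.2
  · intro args a hx
    have hc := hcheck _ hx
    simp only [Fact.check, Token.elim, Bool.and_eq_true, Bool.not_eq_true',
      decide_eq_false_iff_not, decide_eq_true_eq, beq_iff_eq] at hc
    obtain ⟨-, hk, h₀, hiff⟩ := hc
    obtain ⟨⟨k, x⟩, _, rfl, hk₁, hk⟩ := List.map_eq_cons_iff.1 hk
    obtain ⟨⟨k', y⟩, _, rfl, hk₂, hk⟩ := List.map_eq_cons_iff.1 hk
    obtain rfl := List.map_eq_nil_iff.1 hk
    simp only [List.getD_cons_zero] at hk₂ h₀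
    obtain ⟨s, rfl⟩ := Nat.exists_eq_succ_of_ne_zero h₀
    subst hk₂
    refine ⟨s, x, y, rfl, ?_⟩
    have hxy : a = 1 ↔ x = y := by
      rw [Bool.eq_iff_iff, decide_eq_true_eq, decide_eq_true_eq] at hiff
      exact hiff
    rw [hxy]
    refine ⟨fun h => ?_, fun h => by rw [h]⟩
    obtain ⟨z₁, hz₁, hzo₁⟩ := hout _ hx (s + 1, x) (by simp)
    obtain ⟨z₂, hz₂, hzo₂⟩ := hout _ hx (s + 1, y) (by simp)
    have := hinj s z₁ hz₁ z₂ hz₂ (by rw [hzo₁]) (by rw [hzo₂])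
    rw [hzo₁, hzo₂] at this
    exact this h
  · intro args a hx
    have hc := hcheck _ hx
    simp only [Fact.check, Token.elim, Bool.and_eq_true, decide_eq_true_eq, beq_iff_eq] at hc
    obtain ⟨-, hk, hiff⟩ := hc
    obtain ⟨⟨k, x⟩, _, rfl, hk₁, hk⟩ := List.map_eq_cons_iff.1 hk
    obtain ⟨⟨k', y⟩, _, rfl, hk₂, hk⟩ := List.map_eq_cons_iff.1 hk
    obtain rfl := List.map_eq_nil_iff.1 hk
    obtain rfl : k = 0 := hk₁
    obtain rfl : k' = 0 := hk₂
    refine ⟨x, y, rfl, ?_⟩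
    rw [Bool.eq_iff_iff, decide_eq_true_eq, Bool.or_eq_true, Bool.not_eq_true',
      decide_eq_false_iff_not, decide_eq_true_eq] at hiff
    exact imp_iff_not_or.trans hiff.symm
  · intro s n args a hx
    have hc := hcheck _ hx
    simp [Fact.check, Token.elim] at hc

theorem goodFacts_iff : goodFacts S C mS mF mP F = true ↔
    (∀ x ∈ F, x.check S C mS mF mP = true) ∧ ∀ x ∈ F, ∀ y ∈ F, x.compat y = true := by
  simp [goodFacts]

variable {T₁ T₂ : Set Formula} {mS₁ mS₂ : ℕ → Bool} {mF₁ mF₂ : FunSym → Bool}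
  {mP₁ mP₂ : PredSym → Bool}

/-- Satisfiability modulo the union of two theories that share an enumerated data type reduces to
the satisfiability of two pure conjunctions of literals, for one of finitely many annotations. -/
theorem satProblem_union_iff (hT₁ : IsTheory L₁ T₁) (hT₂ : IsTheory L₂ T₂)
    (hshare : L₁ ∩ L₂ = edtSignature S C) (hsub₁ : {edtDistinct S C, edtExhaustive S C} ⊆ T₁)
    (hsub₂ : {edtDistinct S C, edtExhaustive S C} ⊆ T₂)
    (hS₁ : ∀ s, mS₁ s = true ↔ s ∈ L₁.sorts) (hF₁ : ∀ f, mF₁ f = true ↔ f ∈ L₁.funs)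
    (hP₁ : ∀ P, mP₁ P = true ↔ P ∈ L₁.preds) (hS₂ : ∀ s, mS₂ s = true ↔ s ∈ L₂.sorts)
    (hF₂ : ∀ f, mF₂ f = true ↔ f ∈ L₂.funs) (hP₂ : ∀ P, mP₂ P = true ↔ P ∈ L₂.preds)
    (w : List Token) :
    SatProblem (L₁ ∪ L₂) (T₁ ∪ T₂) w ↔ ∃ A ∈ annotations (w.length + C.sum + 2) w,
      (run A).1 = [(0, 1)] ∧ goodFacts S C (fun s => mS₁ s || mS₂ s) (fun f => mF₁ f || mF₂ f)
        (fun P => mP₁ P || mP₂ P) (run A).2 = true ∧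
      SatProblem L₁ T₁ (query S mS₁ mF₁ mP₁ (run A).2) ∧
      SatProblem L₂ T₂ (query S mS₂ mF₂ mP₂ (run A).2) := by
  have hS : ∀ s, (mS₁ s || mS₂ s) = true ↔ s ∈ (L₁ ∪ L₂).sorts := fun s => by
    rw [Bool.or_eq_true, hS₁, hS₂]
    rfl
  have hF : ∀ f, (mF₁ f || mF₂ f) = true ↔ f ∈ (L₁ ∪ L₂).funs := fun f => by
    rw [Bool.or_eq_true, hF₁, hF₂]
    rfl
  have hP : ∀ P, (mP₁ P || mP₂ P) = true ↔ P ∈ (L₁ ∪ L₂).preds := fun P => by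
    rw [Bool.or_eq_true, hP₁, hP₂]
    rfl
  have hsorts : ∀ s, s ∈ L₁.sorts ∧ s ∈ L₂.sorts ↔ s = S := fun s =>
    Set.ext_iff.1 (congrArg Signature.sorts hshare) s
  have hfuns : ∀ f, f ∈ L₁.funs ∧ f ∈ L₂.funs ↔ ∃ c ∈ C, f = ⟨c, [], S⟩ := fun f =>
    Set.ext_iff.1 (congrArg Signature.funs hshare) f
  have hpreds : ∀ P, P ∈ L₁.preds ∧ P ∈ L₂.preds ↔ False := fun P =>
    Set.ext_iff.1 (congrArg Signature.preds hshare) P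
  have hC₁ : ∀ c ∈ C, ⟨c, [], S⟩ ∈ L₁.funs := fun c hc => ((hfuns _).2 ⟨c, hc, rfl⟩).1
  have hC₂ : ∀ c ∈ C, ⟨c, [], S⟩ ∈ L₂.funs := fun c hc => ((hfuns _).2 ⟨c, hc, rfl⟩).2
  constructor
  -- From a model to a guess: annotate `φ` by its values. The bound leaves room for one name per
  -- token, for the names of the constants, and for the truth values `0` and `1`.
  · rintro ⟨φ, rfl, hover, hqf, M, hM, b, v, hreal⟩
    have hM₁ : M.Models T₁ := fun ψ hψ => hM ψ (Or.inl hψ)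
    have hM₂ : M.Models T₂ := fun ψ hψ => hM ψ (Or.inr hψ)
    have hen : Enumerates M S C := Structure.Models.enumerates fun ψ hψ => hM₁ ψ (hsub₁ hψ)
    have hlen : (φ.elements M v).length + C.sum < φ.encode.length + C.sum + 2 := by
      have := φ.length_elements_le (M := M) (v := v)
      omega
    obtain ⟨h, hh⟩ := exists_names hen (φ.elements M v) hlen
    obtain ⟨u, hu⟩ := hh.exists_valuation
    have hread := φ.reads_annotate (b := b) (v := v) (h := h) hover hqf (List.Subset.refl _) []
    rw [List.append_nil] at hread
    have htrue : ∀ x ∈ (run (φ.annotate M b v h)).2,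
        TrueFact (L₁ ∪ L₂) M b v h (φ.elements M v) x := fun x hx =>
      (hread.2 x hx).resolve_left (by simp [run])
    have hgood : ∀ x ∈ (run (φ.annotate M b v h)).2, x.check S C (fun s => mS₁ s || mS₂ s)
        (fun f => mF₁ f || mF₂ f) (fun P => mP₁ P || mP₂ P) = true := fun x hx =>
      (htrue x hx).check hh hS hF hP
    refine ⟨φ.annotate M b v h, mem_annotations.2 ⟨φ.map_fst_annotate, fun p hp => ?_⟩, ?_,
      goodFacts_iff.2 ⟨hgood, fun x hx y hy => (htrue x hx).compat hh (htrue y hy)⟩, ?_, ?_⟩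
    · rw [← map_facts_run (φ.annotate M b v h)] at hp
      obtain ⟨x, hx, rfl⟩ := List.mem_map.1 hp
      exact (htrue x hx).value_lt hh (by omega)
    · rw [hread.1, truth_eq_one.2 hreal]
      rfl
    · exact (satProblem_query hS₁ hF₁ hP₁ hC₁ hgood).2 ⟨M, hM₁, u,
        fun x hx => (htrue x hx).holds hu,
        fun x hx y hy => (htrue x hx).separates hu (htrue y hy)⟩
    · exact (satProblem_query hS₂ hF₂ hP₂ hC₂ hgood).2 ⟨M, hM₂, u,
        fun x hx => (htrue x hx).holds hu,
        fun x hx y hy => (htrue x hx).separates hu (htrue y hy)⟩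
  · rintro ⟨A, hA, hrun, hgood, hq₁, hq₂⟩
    obtain ⟨hcheck, hcompat⟩ := goodFacts_iff.1 hgood
    obtain ⟨M₁, hM₁, u₁, holds₁, hsep₁⟩ := (satProblem_query hS₁ hF₁ hP₁ hC₁ hcheck).1 hq₁
    obtain ⟨M₂, hM₂, u₂, holds₂, hsep₂⟩ := (satProblem_query hS₂ hF₂ hP₂ hC₂ hcheck).1 hq₂
    -- From a guess to a model: the two answers agree on the enumerated sort, hence glue.
    have hen₁ : Enumerates M₁ S C := Structure.Models.enumerates fun ψ hψ => hM₁ ψ (hsub₁ hψ)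
    have hen₂ : Enumerates M₂ S C := Structure.Models.enumerates fun ψ hψ => hM₂ ψ (hsub₂ hψ)
    obtain ⟨M, e₁, e₂, val, he₁, he₂, hval⟩ := exists_glued_structure (L₁ := L₁) (L₂ := L₂)
      hen₁ hen₂ (fun s h₁ h₂ => (hsorts s).1 ⟨h₁, h₂⟩) (fun f h₁ h₂ => (hfuns f).1 ⟨h₁, h₂⟩)
      (fun P h₁ h₂ => (hpreds P).1 ⟨h₁, h₂⟩) u₁ u₂
    obtain ⟨b, v, hI⟩ := exists_interprets hS hF hP ((hsorts S).2 rfl).1 hcheck hcompat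
      (out_of_run A).2 hen₁ he₁ he₂ hval holds₁ holds₂ hsep₁ hsep₂
    obtain ⟨xs, hxs, hrep⟩ := hI.parse A (List.Subset.refl _)
    -- A final stack with the single entry `(0, 1)` means that the whole string is one formula, and
    -- that it is true.
    rw [hrun] at hrep
    obtain ⟨y, _, hφ, hnil, rfl⟩ := List.forall₂_cons_right_iff.1 hrep
    cases hnil
    obtain ⟨φ, rfl, hover, hqf, hreal⟩ := hφ.formula
    refine ⟨φ, ?_, hover, hqf, M, ?_, b, v, hreal.2 rfl⟩
    · rw [← (mem_annotations.1 hA).1, hxs]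
      simp
    · rintro ψ (hψ | hψ)
      · exact he₁.models hT₁ hM₁ ψ hψ
      · exact he₂.models hT₂ hM₂ ψ hψ

open Computable in
theorem DecidableSat.union {L₀ : Signature} {T₀ : Set Formula} (hsub : IsEnumeratedDataType L₀ T₀)
    (hT₁ : IsTheory L₁ T₁) (hT₂ : IsTheory L₂ T₂) (hshare : L₁ ∩ L₂ = L₀) (hsub₁ : T₀ ⊆ T₁)
    (hsub₂ : T₀ ⊆ T₂) (hc₁ : Consistent T₁) (hc₂ : Consistent T₂) (hd₁ : DecidableSat L₁ T₁)
    (hd₂ : DecidableSat L₂ T₂) : DecidableSat (L₁ ∪ L₂) (T₁ ∪ T₂) := by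
  obtain ⟨S, C, -, -, rfl, rfl⟩ := hsub
  obtain ⟨mS₁, cS₁, hS₁⟩ := hd₁.computable_sorts hc₁
  obtain ⟨mF₁, cF₁, hF₁⟩ := hd₁.computable_funs hc₁
  obtain ⟨mP₁, cP₁, hP₁⟩ := hd₁.computable_preds hc₁
  obtain ⟨mS₂, cS₂, hS₂⟩ := hd₂.computable_sorts hc₂
  obtain ⟨mF₂, cF₂, hF₂⟩ := hd₂.computable_funs hc₂
  obtain ⟨mP₂, cP₂, hP₂⟩ := hd₂.computable_preds hc₂
  -- The given decision procedures, used as oracles for the pure queries.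
  obtain ⟨q₁, cq₁, hq₁⟩ := hd₁.computable_preimage Computable.id fun _ => Iff.rfl
  obtain ⟨q₂, cq₂, hq₂⟩ := hd₂.computable_preimage Computable.id fun _ => Iff.rfl
  have hfacts : Computable fun A : List (Token × ℕ) => (run A).2 := snd.comp computable_run
  have htest : Computable fun A : List (Token × ℕ) => decide ((run A).1 = [(0, 1)]) &&
      (goodFacts S C (fun s => mS₁ s || mS₂ s) (fun f => mF₁ f || mF₂ f)
        (fun P => mP₁ P || mP₂ P) (run A).2 &&
      (q₁ (query S mS₁ mF₁ mP₁ (run A).2) && q₂ (query S mS₂ mF₂ mP₂ (run A).2))) :=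
    Computable.and (Computable.beq (fst.comp computable_run) (const _))
      (Computable.and ((computable_goodFacts S C (Computable.or cS₁ cS₂) (Computable.or cF₁ cF₂)
          (Computable.or cP₁ cP₂)).comp hfacts)
        (Computable.and (cq₁.comp ((computable_query S cS₁ cF₁ cP₁).comp hfacts))
          (cq₂.comp ((computable_query S cS₂ cF₂ cP₂).comp hfacts))))
  have hann : Computable fun w : List Token => annotations (w.length + C.sum + 2) w :=
    computable_annotations.comp
      ((Primrec.nat_add.to_comp.comp list_length (const (C.sum + 2))).of_eq fun _ =>
        (Nat.add_assoc _ _ _).symm) Computable.id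
  refine ComputablePred.computable_iff.2 ⟨_, list_any hann (htest.comp snd).to₂, ?_⟩
  funext w
  refine propext ((satProblem_union_iff hT₁ hT₂ hshare hsub₁ hsub₂ hS₁ hF₁ hP₁ hS₂ hF₂ hP₂
    w).trans ?_)
  simp only [List.any_eq_true, Bool.and_eq_true, decide_eq_true_eq, hq₁, hq₂, id]

end Decide

end ManySorted

theorem mainTheorem3
    (Lsub LWF LPM : ManySorted.Signature) (Tsub TWF TPM : Set ManySorted.Formula)
    (hsub : ManySorted.IsEnumeratedDataType Lsub Tsub)
    (hWF : ManySorted.IsTheory LWF TWF) (hPM : ManySorted.IsTheory LPM TPM)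
    (hshare : LWF ∩ LPM = Lsub)
    (hsubWF : Tsub ⊆ TWF) (hsubPM : Tsub ⊆ TPM)
    (hconsWF : ManySorted.Consistent TWF) (hconsPM : ManySorted.Consistent TPM)
    (hdecWF : ManySorted.DecidableSat LWF TWF) (hdecPM : ManySorted.DecidableSat LPM TPM) :
    ManySorted.DecidableSat (LWF ∪ LPM) (TWF ∪ TPM) :=
  ManySorted.DecidableSat.union hsub hWF hPM hshare hsubWF hsubPM hconsWF hconsPM hdecWF hdecPM
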